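/- Let $n\ge 1$, let $\Omega\subset\mathbb{R}^n$ be a bounded Lipschitz domain, and let $K_0\Subset U\Subset\Omega$ be open sets. Then there exist constants $C>0$ and $c>0$, depending only on $(\Omega,U,K_0)$, such that the following holds. Let $\varepsilon>0$ and $q_0>0$, let $q\in L^\infty(\Omega)$ satisfy $q\ge 0$ a.e. in $\Omega$ and $q\ge q_0$ a.e. in $U$, and let $z\in H^1(\Omega)$ be a weak solution of $$-\Delta z+\frac{q}{\varepsilon}z=0\quad\text{in }\Omega$$ with boundary trace $z|_{\partial\Omega}=\phi\in H^{1/2}(\partial\Omega)\cap L^\infty(\partial\Omega)$. Then $$\|z\|_{L^\infty(K_0)}\le C\,\|\phi\|_{L^\infty(\partial\Omega)}\exp\Bigl(-c\sqrt{\frac{q_0}{\varepsilon}}\Bigr).$$ -/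

import Mathlib

open MeasureTheory Filter Topology

noncomputable section

/-- The space `ℝⁿ` with its Euclidean norm. -/
abbrev RSpace (n : ℕ) : Type := EuclideanSpace ℝ (Fin n)

/-- Compact containment `A ⋐ B`: the closure of `A` is compact and contained in `B`. -/
def CompactlyContained {n : ℕ} (A B : Set (RSpace n)) : Prop :=
  IsCompact (closure A) ∧ closure A ⊆ B

/-- Near each of its boundary points, `Ω` lies strictly above the graph of a Lipschitz function,
"above" being meant in the direction of a unit vector `e` (which may depend on the point).
Only the values of `γ` on the hyperplane orthogonal to `e` matter. -/
def HasLipschitzBoundary {n : ℕ} (Ω : Set (RSpace n)) : Prop :=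
  ∀ p ∈ frontier Ω, ∃ (e : RSpace n) (r : ℝ) (L : NNReal) (γ : RSpace n → ℝ),
    ‖e‖ = 1 ∧ 0 < r ∧ LipschitzWith L γ ∧
      ∀ x ∈ Metric.ball p r, x ∈ Ω ↔ γ (x - inner ℝ e x • e) < inner ℝ e x

/-- A bounded Lipschitz domain of `ℝⁿ`. -/
structure IsBoundedLipschitzDomain {n : ℕ} (Ω : Set (RSpace n)) : Prop where
  isOpen : IsOpen Ω
  isConnected : IsConnected Ω
  isBounded : Bornology.IsBounded Ω
  lipschitz : HasLipschitzBoundary Ω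

/-- The surface measure of `∂Ω`: the `(n-1)`-dimensional Hausdorff measure restricted to `∂Ω`.
(The normalization of the Hausdorff measure affects neither convergence in `L²(∂Ω)` nor
the `L^∞(∂Ω)` norm.) -/
def surfaceMeasure {n : ℕ} (Ω : Set (RSpace n)) : Measure (RSpace n) :=
  (Measure.hausdorffMeasure ((n : ℝ) - 1)).restrict (frontier Ω)

/-- Test functions: smooth with compact support contained in `Ω`. -/
structure IsTestFunction {n : ℕ} (Ω : Set (RSpace n)) (ψ : RSpace n → ℝ) : Prop where
  smooth : ContDiff ℝ (⊤ : ℕ∞) ψ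
  hasCompactSupport : HasCompactSupport ψ
  tsupport_subset : tsupport ψ ⊆ Ω

/-- `z ∈ H¹(Ω)` and `G` is (a representative of) its weak gradient. -/
structure HasH1Gradient {n : ℕ} (Ω : Set (RSpace n)) (z : RSpace n → ℝ)
    (G : RSpace n → RSpace n) : Prop where
  memLp : MemLp z 2 (volume.restrict Ω)
  memLp_gradient : MemLp G 2 (volume.restrict Ω)
  integral_eq : ∀ ψ : RSpace n → ℝ, IsTestFunction Ω ψ → ∀ v : RSpace n,
    ∫ x in Ω, z x * fderiv ℝ ψ x v = -∫ x in Ω, inner ℝ (G x) v * ψ x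

/-- `z ∈ H¹(Ω)` is a weak solution of `-Δz + a z = 0` in `Ω`. -/
def IsWeakSolution {n : ℕ} (Ω : Set (RSpace n)) (a z : RSpace n → ℝ) : Prop :=
  ∃ G : RSpace n → RSpace n, HasH1Gradient Ω z G ∧
    ∀ ψ : RSpace n → ℝ, IsTestFunction Ω ψ →
      ∫ x in Ω, (inner ℝ (G x) (gradient ψ x) + a x * z x * ψ x) = 0

/-- `z ∈ H¹(Ω)` has boundary trace `φ ∈ L²(∂Ω)`: the pair `(z, φ)` is the limit in
`H¹(Ω) × L²(∂Ω)` of pairs `(g k|_Ω, g k|_∂Ω)` with `g k` smooth on `ℝⁿ`. On a bounded Lipschitz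
domain this is the graph of the trace operator, which is the continuous extension to `H¹(Ω)` of
the restriction to `∂Ω`; the traces are exactly the elements of `H^{1/2}(∂Ω)`. -/
def HasTrace {n : ℕ} (Ω : Set (RSpace n)) (z φ : RSpace n → ℝ) : Prop :=
  MemLp φ 2 (surfaceMeasure Ω) ∧
  ∃ G : RSpace n → RSpace n, HasH1Gradient Ω z G ∧
    ∃ g : ℕ → RSpace n → ℝ, (∀ k, ContDiff ℝ (⊤ : ℕ∞) (g k)) ∧
      Tendsto (fun k => eLpNorm (fun x => g k x - z x) 2 (volume.restrict Ω)) atTop (𝓝 0) ∧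
      Tendsto (fun k => eLpNorm (fun x => gradient (g k) x - G x) 2 (volume.restrict Ω))
        atTop (𝓝 0) ∧
      Tendsto (fun k => eLpNorm (fun x => g k x - φ x) 2 (surfaceMeasure Ω)) atTop (𝓝 0)

end

/-! The function is compared with explicit barriers. If `W` is smooth, then `u = z - W` satisfies
`-Δu + f = 0` weakly with `f = a z - ΔW`, where `a = q / ε`. Testing with `χ T(u)`, where `χ ≥ 0` is
a cutoff and `T` is bounded, nondecreasing and zero exactly on `(-∞, 0]`, gives `∫ χ T(u) f ≤ -∫
T(u) ∇u · ∇χ`. If `f > 0` wherever `u > 0` and the right side vanishes or tends to zero, then `T(u)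
f = 0`, that is `u ≤ 0`. The choice `T = expNegInvGlue` is a smooth substitute for the positive
part: `T(h k)` is smooth for each smooth approximation `h k` of `u`, so no chain rule for Sobolev
functions is needed, only limits.

Two barriers are used. The first, `W = M + η (R² - |x|²)` with `M` the bound for `φ` and `η → 0`,
makes `f` strictly positive where `u > 0` and gives `z ≤ M` in `Ω`
(`IsApproxSolution.le_of_boundary_le`). Here the cutoffs approach `1` and the error lives in a
boundary strip of width `δ`, where `|∇χ| ≤ 4 / δ`. A Poincaré inequality along the Lipschitz charts
bounds `∫ T(u)²` over the strip by `C δ² ∫ |∇u|²` over a comparable strip, because `T(u)` has zero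
boundary values. The factors of `δ` cancel and what remains is the energy of a shrinking strip,
which tends to zero.

The second barrier, `W = κ ∑ cosh (λ (xᵢ - bᵢ))` with `λ² = q₀ / ε`, satisfies `ΔW = λ² W` and lives
on a ball of `U` centred at `b ∈ K₀`. With `κ = M / cosh (λ s)` it exceeds `M ≥ z` where the cutoff
of the ball varies, so the error term is exactly zero and `z ≤ W` (`IsApproxSolution.le_exp`). Near
the centre `W` is exponentially small. Applying both bounds to `z` and `-z`, uniformly in `b ∈ K₀`,
gives the estimate. -/

noncomputable section

variable {n : ℕ}

/-! ### The truncation `T = expNegInvGlue`: bounds for `T` and `T'` -/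

namespace expNegInvGlue

theorem le_one (x : ℝ) : expNegInvGlue x ≤ 1 := by
  unfold expNegInvGlue
  split_ifs with h
  · exact zero_le_one
  · rw [Real.exp_le_one_iff]
    have := inv_pos.2 (not_le.1 h)
    linarith

/-- The formula is also valid at `x = 0`, where `0⁻¹ = 0`, and for `x < 0`, where the glue function
vanishes. -/
theorem hasDerivAt (x : ℝ) : HasDerivAt expNegInvGlue ((x⁻¹) ^ 2 * expNegInvGlue x) x := by
  simpa using hasDerivAt_polynomial_eval_inv_mul 1 x

theorem deriv_nonneg (x : ℝ) : 0 ≤ (x⁻¹) ^ 2 * expNegInvGlue x :=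
  mul_nonneg (sq_nonneg _) (nonneg x)

/-- With `y = x⁻¹ > 0` this is `y² e⁻ʸ ≤ 2`, a consequence of `1 + y + y² / 2 ≤ eʸ`. -/
theorem deriv_le_two (x : ℝ) : (x⁻¹) ^ 2 * expNegInvGlue x ≤ 2 := by
  unfold expNegInvGlue
  split_ifs with h
  · simp
  · have hx := inv_pos.2 (not_le.1 h)
    have := Real.quadratic_le_exp_of_nonneg hx.le
    rw [Real.exp_neg, ← div_eq_mul_inv, div_le_iff₀ (Real.exp_pos _)]
    nlinarith

theorem continuous_deriv : Continuous fun x : ℝ => (x⁻¹) ^ 2 * expNegInvGlue x := by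
  have := continuous_polynomial_eval_inv_mul (Polynomial.X ^ 2)
  simpa only [Polynomial.eval_pow, Polynomial.eval_X] using this

theorem continuous : Continuous expNegInvGlue :=
  (expNegInvGlue.contDiff (n := 0)).continuous

end expNegInvGlue

/-! ### Gradients and `L²` pairings -/

theorem norm_gradient_eq (f : RSpace n → ℝ) (x : RSpace n) : ‖gradient f x‖ = ‖fderiv ℝ f x‖ := by
  simp [gradient]

theorem ContDiff.continuous_gradient {f : RSpace n → ℝ} (hf : ContDiff ℝ (⊤ : ℕ∞) f) :
    Continuous (gradient f) :=
  (LinearIsometryEquiv.continuous _).comp (hf.continuous_fderiv (by simp))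

theorem HasCompactSupport.gradient {f : RSpace n → ℝ} (hf : HasCompactSupport f) :
    HasCompactSupport (gradient f) :=
  (hf.fderiv ℝ).comp_left (map_zero _)

theorem gradient_mul_comp {χ h : RSpace n → ℝ} {T : ℝ → ℝ} {T' : ℝ} {x : RSpace n}
    (hχ : DifferentiableAt ℝ χ x) (hh : DifferentiableAt ℝ h x) (hT : HasDerivAt T T' (h x)) :
    gradient (fun y => χ y * T (h y)) x = T (h x) • gradient χ x + (χ x * T') • gradient h x := by
  have h1 := hχ.hasFDerivAt.mul (hT.comp_hasFDerivAt x hh.hasFDerivAt)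
  unfold gradient
  rw [show (fun y => χ y * T (h y)) = χ * (T ∘ h) from rfl, h1.fderiv]
  simp only [map_add, map_smul, smul_smul, Function.comp]
  rw [add_comm]

theorem gradient_comp {h : RSpace n → ℝ} {T : ℝ → ℝ} {T' : ℝ} {x : RSpace n}
    (hh : DifferentiableAt ℝ h x) (hT : HasDerivAt T T' (h x)) :
    gradient (fun y => T (h y)) x = T' • gradient h x := by
  simpa using gradient_mul_comp (χ := fun _ => 1) (differentiableAt_const _) hh hT

section Lp

variable {α E : Type*} [MeasurableSpace α] {μ : Measure α}
  [NormedAddCommGroup E] [InnerProductSpace ℝ E]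

theorem MeasureTheory.MemLp.integrable_inner {H V : α → E} (hH : MemLp H 2 μ) (hV : MemLp V 2 μ) :
    Integrable (fun x => (inner ℝ (H x) (V x) : ℝ)) μ :=
  memLp_one_iff_integrable.1 <| hH.of_bilin (fun x y => inner ℝ x y) 1 hV
    (hH.1.inner hV.1) (Eventually.of_forall fun x => by
      rw [one_mul]; exact nnnorm_inner_le_nnnorm (𝕜 := ℝ) _ _)

/-- Integrals against `L²`-null sequences with bounded coefficients tend to zero. -/
theorem tendsto_integral_mul_inner_zero {β : ℕ → α → ℝ} {B : ℝ} {H : α → E} {D : ℕ → α → E}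
    (hβ : ∀ k x, |β k x| ≤ B) (hH : MemLp H 2 μ) (hD : ∀ k, AEStronglyMeasurable (D k) μ)
    (hlim : Tendsto (fun k => eLpNorm (D k) 2 μ) atTop (𝓝 0)) :
    Tendsto (fun k => ∫ x, β k x * inner ℝ (H x) (D k x) ∂μ) atTop (𝓝 0) := by
  have key : ∀ k, ‖∫ x, β k x * inner ℝ (H x) (D k x) ∂μ‖ₑ
      ≤ ENNReal.ofReal B * (eLpNorm H 2 μ * eLpNorm (D k) 2 μ) := by
    intro k
    have h1 := eLpNorm_le_eLpNorm_mul_eLpNorm_of_nnnorm (p := 2) (q := 2) (r := 1) hH.1 (hD k)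
      (fun x y => (inner ℝ x y : ℝ)) 1 (Eventually.of_forall fun x => by
        rw [one_mul]; exact nnnorm_inner_le_nnnorm (𝕜 := ℝ) _ _)
    rw [ENNReal.coe_one, one_mul, eLpNorm_one_eq_lintegral_enorm] at h1
    refine (enorm_integral_le_lintegral_enorm _).trans (le_trans ?_ (mul_le_mul_right h1 _))
    rw [← lintegral_const_mul' _ _ ENNReal.ofReal_ne_top]
    refine lintegral_mono fun x => ?_
    rw [enorm_mul]
    gcongr
    rw [Real.enorm_eq_ofReal_abs]
    exact ENNReal.ofReal_le_ofReal (hβ k x)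
  rw [tendsto_zero_iff_enorm_tendsto_zero]
  refine tendsto_of_tendsto_of_tendsto_of_le_of_le tendsto_const_nhds ?_ (fun _ => zero_le) key
  have : Tendsto (fun k => ENNReal.ofReal B * (eLpNorm H 2 μ * eLpNorm (D k) 2 μ)) atTop
      (𝓝 (ENNReal.ofReal B * (eLpNorm H 2 μ * 0))) :=
    ENNReal.Tendsto.const_mul (ENNReal.Tendsto.const_mul hlim (Or.inr hH.2.ne))
      (Or.inr ENNReal.ofReal_ne_top)
  simpa using this

end Lp

/-! ### The equation tested with `χ T(u)` -/

theorem IsTestFunction.mul_comp {Ω : Set (RSpace n)} {χ h : RSpace n → ℝ} (hχ : IsTestFunction Ω χ)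
    (hh : ContDiff ℝ (⊤ : ℕ∞) h) {T : ℝ → ℝ} (hT : ContDiff ℝ (⊤ : ℕ∞) T) :
    IsTestFunction Ω fun x => χ x * T (h x) where
  smooth := hχ.smooth.mul (hT.comp hh)
  hasCompactSupport := hχ.hasCompactSupport.mul_right
  tsupport_subset := (tsupport_mul_subset_left (g := fun x => T (h x))).trans hχ.tsupport_subset

/-- The smooth functions `h k` converge to `u` almost everywhere in `Ω`, and their gradients
converge to `H` in `L²(Ω)`. -/
structure IsSmoothApprox (Ω : Set (RSpace n)) (u : RSpace n → ℝ) (H : RSpace n → RSpace n)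
    (h : ℕ → RSpace n → ℝ) : Prop where
  memLp_gradient : MemLp H 2 (volume.restrict Ω)
  contDiff : ∀ k, ContDiff ℝ (⊤ : ℕ∞) (h k)
  tendsto_ae : ∀ᵐ x ∂(volume.restrict Ω), Tendsto (fun k => h k x) atTop (𝓝 (u x))
  tendsto_gradient : Tendsto (fun k => eLpNorm (fun x => gradient (h k) x - H x) 2
    (volume.restrict Ω)) atTop (𝓝 0)

theorem IsTestFunction.exists_bound {Ω : Set (RSpace n)} {χ : RSpace n → ℝ}
    (hχ : IsTestFunction Ω χ) : ∃ B : ℝ, ∀ x, |χ x| ≤ B :=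
  hχ.hasCompactSupport.exists_bound_of_continuous hχ.smooth.continuous

/-- Testing the equation with `χ T(u)`, where `T` is smooth, bounded and increasing. -/
theorem integral_mul_expNegInvGlue_le {Ω : Set (RSpace n)} {u f : RSpace n → ℝ}
    {H : RSpace n → RSpace n} {h : ℕ → RSpace n → ℝ} (A : IsSmoothApprox Ω u H h)
    (hΩ : Bornology.IsBounded Ω) (hf : MemLp f 2 (volume.restrict Ω))
    (heq : ∀ ψ, IsTestFunction Ω ψ → ∫ x in Ω, (inner ℝ (H x) (gradient ψ x) + f x * ψ x) = 0)
    {χ : RSpace n → ℝ} (hχ : IsTestFunction Ω χ) (hχ0 : ∀ x, 0 ≤ χ x) :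
    ∫ x in Ω, χ x * expNegInvGlue (u x) * f x ≤
      -∫ x in Ω, expNegInvGlue (u x) * inner ℝ (H x) (gradient χ x) := by
  set μ := (volume : Measure (RSpace n)).restrict Ω with hμ
  have : IsFiniteMeasure μ := ⟨by
    rw [hμ, Measure.restrict_apply_univ]; exact hΩ.measure_lt_top⟩
  obtain ⟨B, hB⟩ := hχ.exists_bound
  have hfi : Integrable f μ := hf.integrable one_le_two
  have hTc : ∀ k, Continuous fun x => expNegInvGlue (h k x) := fun k =>
    expNegInvGlue.continuous.comp (A.contDiff k).continuous
  have hT1 : ∀ x, ‖expNegInvGlue x‖ ≤ 1 := fun x => by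
    rw [Real.norm_of_nonneg (expNegInvGlue.nonneg _)]; exact expNegInvGlue.le_one _
  have hgχ : MemLp (gradient χ) 2 μ :=
    (hχ.smooth.continuous_gradient.memLp_of_hasCompactSupport hχ.hasCompactSupport.gradient)
  have hHχ := A.memLp_gradient.integrable_inner hgχ
  -- the three terms of the tested equation
  have i1 : ∀ k, Integrable (fun x => expNegInvGlue (h k x) * inner ℝ (H x) (gradient χ x)) μ :=
    fun k => hHχ.bdd_mul (hTc k).aestronglyMeasurable (Eventually.of_forall fun x => hT1 _)
  have i3 : ∀ k, Integrable (fun x => (χ x * expNegInvGlue (h k x)) * f x) μ := fun k =>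
    hfi.bdd_mul (c := B) (hχ.smooth.continuous.mul (hTc k)).aestronglyMeasurable
      (Eventually.of_forall fun x => by
        rw [norm_mul]
        calc _ ≤ |χ x| * 1 := by gcongr; exacts [le_rfl, hT1 _]
          _ ≤ B := by rw [mul_one]; exact hB x)
  set β : ℕ → RSpace n → ℝ := fun k x => χ x * ((h k x)⁻¹ ^ 2 * expNegInvGlue (h k x)) with hβ
  have hβc : ∀ k, Continuous (β k) := fun k => hχ.smooth.continuous.mul
    (expNegInvGlue.continuous_deriv.comp (A.contDiff k).continuous)
  have hβ0 : ∀ k x, 0 ≤ β k x := fun k x => mul_nonneg (hχ0 x) (expNegInvGlue.deriv_nonneg _)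
  have hβB : ∀ k x, |β k x| ≤ B * 2 := fun k x => by
    rw [abs_mul, abs_of_nonneg (expNegInvGlue.deriv_nonneg _)]
    exact mul_le_mul (hB x) (expNegInvGlue.deriv_le_two _) (expNegInvGlue.deriv_nonneg _)
      ((abs_nonneg _).trans (hB x))
  have iH : ∀ k, Integrable (fun x => β k x * inner ℝ (H x) (H x)) μ := fun k =>
    (A.memLp_gradient.integrable_inner A.memLp_gradient).bdd_mul (hβc k).aestronglyMeasurable
      (Eventually.of_forall fun x => hβB k x)
  have hg : ∀ k x, gradient (fun y => χ y * expNegInvGlue (h k y)) x =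
      expNegInvGlue (h k x) • gradient χ x + β k x • gradient (h k) x := fun k x =>
    gradient_mul_comp (hχ.smooth.differentiable (by simp) x)
      ((A.contDiff k).differentiable (by simp) x) (expNegInvGlue.hasDerivAt _)
  have htest : ∀ k, IsTestFunction Ω fun y => χ y * expNegInvGlue (h k y) := fun k =>
    hχ.mul_comp (A.contDiff k) expNegInvGlue.contDiff
  have i2 : ∀ k, Integrable (fun x => β k x * inner ℝ (H x) (gradient (h k) x)) μ := fun k => by
    have h1 := A.memLp_gradient.integrable_inner (V := gradient _)
      ((htest k).smooth.continuous_gradient.memLp_of_hasCompactSupport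
        (htest k).hasCompactSupport.gradient)
    refine (h1.sub (i1 k)).congr (Eventually.of_forall fun x => ?_)
    simp only [Pi.sub_apply, hg, inner_add_right, inner_smul_right]
    ring
  -- Split `∇(h k) = H + (∇(h k) - H)` in the term carrying `T'(h k)`. The part `χ T'(h k) |H|²` is
  -- nonnegative and is dropped; the other tends to zero because `T'` is bounded. No limit of `T'(h
  -- k)` is needed.
  have main : ∀ k, ∫ x, expNegInvGlue (h k x) * inner ℝ (H x) (gradient χ x) ∂μ +
      ∫ x, (χ x * expNegInvGlue (h k x)) * f x ∂μ ≤
      -∫ x, β k x * inner ℝ (H x) (gradient (h k) x - H x) ∂μ := by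
    intro k
    have e1 := heq _ (htest k)
    have e2 : ∫ x in Ω, (inner ℝ (H x) (gradient (fun y => χ y * expNegInvGlue (h k y)) x) +
        f x * (χ x * expNegInvGlue (h k x))) =
        ∫ x, ((expNegInvGlue (h k x) * inner ℝ (H x) (gradient χ x) +
          (χ x * expNegInvGlue (h k x)) * f x) +
          β k x * inner ℝ (H x) (gradient (h k) x)) ∂μ := by
      refine integral_congr_ae (Eventually.of_forall fun x => ?_)
      simp only [hg, inner_add_right, inner_smul_right]
      ring
    have i13 := (i1 k).add (i3 k)
    simp only [Pi.add_def] at i13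
    rw [e2, integral_add i13 (i2 k), integral_add (i1 k) (i3 k)] at e1
    have e3 : ∫ x, β k x * inner ℝ (H x) (gradient (h k) x - H x) ∂μ =
        ∫ x, β k x * inner ℝ (H x) (gradient (h k) x) ∂μ - ∫ x, β k x * inner ℝ (H x) (H x) ∂μ := by
      rw [← integral_sub (i2 k) (iH k)]
      refine integral_congr_ae (Eventually.of_forall fun x => ?_)
      simp only [inner_sub_right]
      ring
    have e4 : 0 ≤ ∫ x, β k x * inner ℝ (H x) (H x) ∂μ :=
      integral_nonneg fun x => mul_nonneg (hβ0 k x) real_inner_self_nonneg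
    linarith
  have hTae : ∀ᵐ x ∂μ, Tendsto (fun k => expNegInvGlue (h k x)) atTop
      (𝓝 (expNegInvGlue (u x))) := by
    filter_upwards [A.tendsto_ae] with x hx
    exact (expNegInvGlue.continuous.tendsto _).comp hx
  have l1 : Tendsto (fun k => ∫ x, expNegInvGlue (h k x) * inner ℝ (H x) (gradient χ x) ∂μ) atTop
      (𝓝 (∫ x, expNegInvGlue (u x) * inner ℝ (H x) (gradient χ x) ∂μ)) := by
    refine tendsto_integral_of_dominated_convergence _ (fun k => (i1 k).1) hHχ.norm
      (fun k => Eventually.of_forall fun x => ?_) ?_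
    · rw [norm_mul]; exact mul_le_of_le_one_left (norm_nonneg _) (hT1 _)
    · filter_upwards [hTae] with x hx using hx.mul_const _
  have l3 : Tendsto (fun k => ∫ x, (χ x * expNegInvGlue (h k x)) * f x ∂μ) atTop
      (𝓝 (∫ x, (χ x * expNegInvGlue (u x)) * f x ∂μ)) := by
    refine tendsto_integral_of_dominated_convergence (fun x => B * ‖f x‖) (fun k => (i3 k).1)
      (hfi.norm.const_mul _) (fun k => Eventually.of_forall fun x => ?_) ?_
    · rw [norm_mul, norm_mul]
      gcongr
      calc _ ≤ |χ x| * 1 := by gcongr; exacts [le_rfl, hT1 _]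
        _ ≤ B := by rw [mul_one]; exact hB x
    · filter_upwards [hTae] with x hx using (hx.const_mul _).mul_const _
  have l2 := tendsto_integral_mul_inner_zero hβB A.memLp_gradient
    (fun k => (A.contDiff k).continuous_gradient.aestronglyMeasurable.sub A.memLp_gradient.1)
    A.tendsto_gradient
  have := le_of_tendsto_of_tendsto' (l1.add l3) l2.neg main
  linarith

/-! ### Lipschitz charts and the boundary strip -/

/-- The component of `x` orthogonal to the unit vector `e`. -/
def perp (e x : RSpace n) : RSpace n := x - (inner ℝ e x : ℝ) • e

theorem perp_eq_starProjection {e : RSpace n} (he : ‖e‖ = 1) (x : RSpace n) :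
    perp e x = (ℝ ∙ e)ᗮ.starProjection x := by
  simp [perp, Submodule.starProjection_orthogonal_val, Submodule.starProjection_singleton, he]

theorem perp_sub (e x y : RSpace n) : perp e x - perp e y = perp e (x - y) := by
  simp only [perp, inner_sub_right, sub_smul]; abel

theorem norm_perp_le {e : RSpace n} (he : ‖e‖ = 1) (x : RSpace n) : ‖perp e x‖ ≤ ‖x‖ := by
  rw [perp_eq_starProjection he]
  exact Submodule.norm_starProjection_apply_le _ _

theorem perp_sub_smul {e : RSpace n} (he : ‖e‖ = 1) (x : RSpace n) (t : ℝ) :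
    perp e (x - t • e) = perp e x := by
  simp [perp, inner_sub_right, inner_smul_right, he, sub_smul]

theorem continuous_perp (e : RSpace n) : Continuous (perp e) := by
  unfold perp; fun_prop

/-- The cylinder over a set of vanishing `(n-1)`-dimensional Hausdorff measure is a null set. -/
theorem volume_perp_preimage_eq_zero (hn : 1 ≤ n) {e : RSpace n} (he : ‖e‖ = 1)
    {N : Set (RSpace n)} (hN : Measure.hausdorffMeasure ((n : ℝ) - 1) N = 0) :
    volume {x | ∃ y ∈ N, perp e x = perp e y} = 0 := by
  obtain ⟨m, rfl⟩ : ∃ m, n = m + 1 := ⟨n - 1, by omega⟩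
  set F := (ℝ ∙ e)ᗮ with hF
  have : Fact (Module.finrank ℝ (RSpace (m + 1)) = m + 1) := ⟨by simp⟩
  have hfin : Module.finrank ℝ F = m :=
    Submodule.finrank_orthogonal_span_singleton (by rintro rfl; simp at he)
  have hd : (((m + 1 : ℕ) : ℝ) - 1) = Module.finrank ℝ F := by rw [hfin]; push_cast; ring
  -- The projection onto `e^⊥` is 1-Lipschitz, so the image of `N` is null for the Hausdorff measure
  -- of dimension `n - 1`. On `e^⊥` that measure is a Haar measure, and preimages of null sets under
  -- a surjective linear map are null.
  set P := F.orthogonalProjectionOnto with hP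
  have hPl : LipschitzWith 1 P := by
    refine P.lipschitz.weaken ?_
    exact Submodule.orthogonalProjectionOnto_norm_le F
  rw [hd] at hN
  have h0 : Measure.hausdorffMeasure (Module.finrank ℝ F : ℝ) (P '' N) = 0 := by
    have := hPl.hausdorffMeasure_image_le (d := (Module.finrank ℝ F : ℝ)) (by positivity) N
    rwa [hN, mul_zero, nonpos_iff_eq_zero] at this
  set ν : Measure F := Measure.hausdorffMeasure (Module.finrank ℝ F : ℝ) with hν
  have : ν.IsAddHaarMeasure := MeasureTheory.isAddHaarMeasure_hausdorffMeasure
  set Z := toMeasurable ν (P '' N)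
  have hZ : ν Z = 0 := by rw [measure_toMeasurable, h0]
  have hsurj : Function.Surjective (P : RSpace (m + 1) →ₗ[ℝ] F) := fun y =>
    ⟨y, by simp [hP]⟩
  have := (ae_comp_linearMap_mem_iff (P : RSpace (m + 1) →ₗ[ℝ] F) volume ν hsurj
    (measurableSet_toMeasurable ν (P '' N)).compl).2
    (by rw [ae_iff]; simpa only [Set.mem_compl_iff, not_not, Set.ofPred_mem_eq] using hZ)
  rw [ae_iff] at this
  refine measure_mono_null ?_ this
  rintro x ⟨y, hy, hxy⟩
  have hPxy : P x = P y := by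
    apply Subtype.ext
    have := hxy
    rw [perp_eq_starProjection he, perp_eq_starProjection he] at this
    exact this
  simp only [Set.mem_ofPred_eq, Set.mem_compl_iff, not_not]
  exact subset_toMeasurable _ _ ⟨y, hy, hPxy.symm⟩

/-- The points of `Ω` at distance less than `δ` from the complement. -/
def strip (Ω : Set (RSpace n)) (δ : ℝ) : Set (RSpace n) := {x | x ∈ Ω ∧ Metric.infDist x Ωᶜ < δ}

theorem isOpen_strip {Ω : Set (RSpace n)} (hΩ : IsOpen Ω) (δ : ℝ) : IsOpen (strip Ω δ) :=
  hΩ.inter (isOpen_lt (Metric.continuous_infDist_pt _) continuous_const)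

theorem strip_subset (Ω : Set (RSpace n)) (δ : ℝ) : strip Ω δ ⊆ Ω := fun _ h => h.1

/-- Near a point of a Lipschitz boundary, following a fixed direction leads to the boundary within
a length comparable to the distance. -/
theorem HasLipschitzBoundary.exists_chart {Ω : Set (RSpace n)} (hΩ : IsOpen Ω)
    (hlip : HasLipschitzBoundary Ω) {p : RSpace n} (hp : p ∈ frontier Ω) :
    ∃ (e : RSpace n) (s : RSpace n → ℝ) (ρ K : ℝ), ‖e‖ = 1 ∧ 0 < ρ ∧ 1 ≤ K ∧ Continuous s ∧
      (∀ x ∈ Ω ∩ Metric.ball p ρ, 0 < s x ∧ x - s x • e ∈ frontier Ω ∧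
        ∀ t ∈ Set.Ico 0 (s x), x - t • e ∈ Ω) ∧
      ∀ x ∈ Ω ∩ Metric.ball p ρ, ∀ δ ≤ ρ, Metric.infDist x Ωᶜ < δ → s x ≤ K * δ := by
  obtain ⟨e, r, L, γ, he, hr, hγ, hiff⟩ := hlip p hp
  -- The height above the graph in the direction `e`: its sign decides membership in `Ω` near `p`,
  -- it drops by `t` along `-t e`, and it is Lipschitz with constant `1 + L`.
  set s : RSpace n → ℝ := fun x => inner ℝ e x - γ (perp e x) with hs
  have hsc : Continuous s := by
    have := hγ.continuous.comp (continuous_perp e)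
    exact (continuous_const.inner continuous_id).sub this
  have hmem : ∀ x ∈ Metric.ball p r, x ∈ Ω ↔ 0 < s x := fun x hx => by
    rw [hiff x hx, hs, sub_pos]; rfl
  have hsl : ∀ x y, s x - s y ≤ (1 + L) * dist x y := fun x y => by
    have h1 : (inner ℝ e x : ℝ) - inner ℝ e y ≤ dist x y := by
      rw [← inner_sub_right, dist_eq_norm]
      simpa [he] using real_inner_le_norm e (x - y)
    have h2 := hγ.dist_le_mul (perp e y) (perp e x)
    rw [dist_eq_norm (perp e y), perp_sub, Real.dist_eq] at h2
    have h3 : γ (perp e y) - γ (perp e x) ≤ L * dist x y := by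
      refine (le_abs_self _).trans (h2.trans ?_)
      rw [dist_comm, dist_eq_norm]
      gcongr
      exact norm_perp_le he _
    simp only [hs]; linarith
  have hst : ∀ x t, s (x - t • e) = s x - t := fun x t => by
    simp only [hs, perp_sub_smul he, inner_sub_right, inner_smul_right, real_inner_self_eq_norm_sq,
      he]; ring
  have hsp : s p = 0 := by
    apply le_antisymm
    · by_contra! h
      have : p ∈ Ω := (hmem p (Metric.mem_ball_self hr)).2 h
      rw [hΩ.frontier_eq] at hp
      exact hp.2 this
    · by_contra! h
      have : ∀ᶠ x in 𝓝 p, s x < 0 ∧ x ∈ Metric.ball p r :=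
        (hsc.continuousAt.eventually_lt continuousAt_const h).and (Metric.ball_mem_nhds p hr)
      obtain ⟨x, hx, hxΩ⟩ := mem_closure_iff_nhds.1 (frontier_subset_closure hp) _ this
      have := (hmem x hx.2).1 hxΩ
      linarith [hx.1]
  have hL : (0 : ℝ) ≤ L := L.2
  -- Since `s x ≤ (1 + L) |x - p|`, the segment from `x` down to the graph stays within `(2 + L) |x
  -- - p| < r` of `p`, where the chart is valid.
  refine ⟨e, s, r / (2 + L), 1 + L, he, by positivity, by linarith, hsc, ?_, ?_⟩
  · rintro x ⟨hxΩ, hxb⟩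
    rw [Metric.mem_ball, lt_div_iff₀ (by positivity)] at hxb
    have hxr : x ∈ Metric.ball p r := by
      rw [Metric.mem_ball]; nlinarith [dist_nonneg (x := x) (y := p)]
    have hsx := (hmem x hxr).1 hxΩ
    have hseg : ∀ t ∈ Set.Icc 0 (s x), x - t • e ∈ Metric.ball p r := by
      rintro t ⟨ht0, ht1⟩
      rw [Metric.mem_ball]
      have h1 := hsl x p
      have h2 : dist (x - t • e) x = t := by
        rw [dist_eq_norm]; simp [norm_smul, he, abs_of_nonneg ht0]
      have h3 := dist_triangle (x - t • e) x p
      nlinarith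
    have hin : ∀ t ∈ Set.Ico 0 (s x), x - t • e ∈ Ω := fun t ht => by
      rw [hmem _ (hseg t ⟨ht.1, ht.2.le⟩), hst]; linarith [ht.2]
    refine ⟨hsx, ?_, hin⟩
    rw [hΩ.frontier_eq]
    refine ⟨?_, ?_⟩
    · have hc : ContinuousWithinAt (fun t : ℝ => x - t • e) (Set.Ico 0 (s x)) (s x) := by
        have : Continuous (fun t : ℝ => x - t • e) := by fun_prop
        exact this.continuousWithinAt
      refine hc.mem_closure ?_ hin
      rw [closure_Ico hsx.ne]
      exact ⟨hsx.le, le_rfl⟩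
    · rw [hmem _ (hseg _ ⟨hsx.le, le_rfl⟩), hst]; simp
  · rintro x ⟨hxΩ, hxb⟩ δ hδ hdist
    have hne : (Ωᶜ).Nonempty := ⟨p, by rw [hΩ.frontier_eq] at hp; exact hp.2⟩
    obtain ⟨y, hy, hxy⟩ := (Metric.infDist_lt_iff hne).1 hdist
    rw [Metric.mem_ball, lt_div_iff₀ (by positivity)] at hxb
    rw [le_div_iff₀ (by positivity)] at hδ
    have hyr : y ∈ Metric.ball p r := by
      rw [Metric.mem_ball]
      have := dist_triangle_left y p x
      nlinarith [dist_nonneg (x := x) (y := p), dist_nonneg (x := x) (y := y)]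
    -- A point `y` outside `Ω` with `|x - y| < δ` has height at most zero, whence `s x ≤ s x - s y ≤
    -- (1 + L) δ`.
    have hsy : s y ≤ 0 := not_lt.1 fun h => hy ((hmem y hyr).2 h)
    have := hsl x y
    nlinarith

/-! ### Poincaré inequality in a boundary strip -/

theorem lintegral_sq_le {α : Type*} [MeasurableSpace α] (μ : Measure α) {g : α → ENNReal}
    (hg : AEMeasurable g μ) : (∫⁻ x, g x ∂μ) ^ 2 ≤ μ Set.univ * ∫⁻ x, g x ^ 2 ∂μ := by
  have h := ENNReal.lintegral_mul_le_Lp_mul_Lq μ Real.HolderConjugate.two_two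
    hg (aemeasurable_const (b := (1 : ENNReal)))
  simp only [Pi.mul_apply, mul_one, lintegral_const, ENNReal.rpow_ofNat, one_pow, one_mul] at h
  calc (∫⁻ x, g x ∂μ) ^ 2 ≤ ((∫⁻ x, g x ^ 2 ∂μ) ^ (1 / 2 : ℝ) * μ Set.univ ^ (1 / 2 : ℝ)) ^ 2 := by
        gcongr
    _ = μ Set.univ * ∫⁻ x, g x ^ 2 ∂μ := by
        rw [mul_pow, ← ENNReal.rpow_natCast, ← ENNReal.rpow_natCast, ← ENNReal.rpow_mul,
          ← ENNReal.rpow_mul, mul_comm]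
        norm_num

theorem ENNReal.add_sq_le_two_mul (a b : ENNReal) : (a + b) ^ 2 ≤ 2 * a ^ 2 + 2 * b ^ 2 := by
  have := ENNReal.rpow_add_le_mul_rpow_add_rpow a b (p := 2) (by norm_num)
  norm_num at this
  rwa [mul_add] at this

/-- A Poincaré type inequality in a boundary strip, with boundary term. -/
theorem lintegral_strip_sq_le {Ω : Set (RSpace n)} (hΩ : IsOpen Ω) {e : RSpace n}
    {s : RSpace n → ℝ} {b : ℝ} {A : Set (RSpace n)} (he : ‖e‖ = 1) (hA : MeasurableSet A)
    (hs : Measurable s)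
    (hchart : ∀ x ∈ A, 0 < s x ∧ x - s x • e ∈ frontier Ω ∧ ∀ t ∈ Set.Ico 0 (s x), x - t • e ∈ Ω)
    (hsb : ∀ x ∈ A, s x ≤ b) {f : RSpace n → ℝ} (hf : ContDiff ℝ (⊤ : ℕ∞) f) :
    ∫⁻ x in A, ‖f x‖ₑ ^ 2 ≤ 2 * (∫⁻ x in A, ‖f (x - s x • e)‖ₑ ^ 2) +
      2 * ENNReal.ofReal b ^ 2 * ∫⁻ x in strip Ω b, ‖gradient f x‖ₑ ^ 2 := by
  set S := strip Ω b with hS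
  have hSm : MeasurableSet S := (isOpen_strip hΩ b).measurableSet
  -- Extension by zero lets the shifted gradient be integrated over the whole space. After Fubini,
  -- translation invariance for each fixed `t` replaces any change of variables along the chart.
  set g : RSpace n → ENNReal := S.indicator fun x => ‖gradient f x‖ₑ with hg
  have hgm : Measurable g := (hf.continuous_gradient.measurable.enorm).indicator hSm
  set I : Measure ℝ := volume.restrict (Set.Ioo 0 b) with hI
  have hIu : I Set.univ = ENNReal.ofReal b := by simp [hI]
  have hpt : ∀ x ∈ A, ‖f x‖ₑ ≤ ‖f (x - s x • e)‖ₑ + ∫⁻ t, g (x - t • e) ∂I := by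
    intro x hx
    obtain ⟨hsx, hfr, hin⟩ := hchart x hx
    have hd : ∀ t ∈ Set.uIcc 0 (s x), HasDerivAt (fun t : ℝ => f (x - t • e))
        (-(fderiv ℝ f (x - t • e) e)) t := fun t _ => by
      have h1 : HasDerivAt (fun t : ℝ => x - t • e) (-e) t := by
        simpa using ((hasDerivAt_id t).smul_const e).const_sub x
      have h2 := ((hf.differentiable (by simp)) (x - t • e)).hasFDerivAt
      simpa [Function.comp_def] using h2.comp_hasDerivAt t h1
    have hc : Continuous fun t : ℝ => -(fderiv ℝ f (x - t • e) e) := by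
      have h1 : Continuous (fderiv ℝ f) := hf.continuous_fderiv (by simp)
      fun_prop
    have hint := intervalIntegral.integral_eq_sub_of_hasDerivAt hd (hc.intervalIntegrable _ _)
    simp only [zero_smul, sub_zero] at hint
    have hfx : f x = f (x - s x • e) - ∫ t in (0 : ℝ)..(s x), -(fderiv ℝ f (x - t • e) e) := by
      rw [hint]; ring
    have hbound : ‖∫ t in (0 : ℝ)..(s x), -(fderiv ℝ f (x - t • e) e)‖ₑ ≤
        ∫⁻ t, g (x - t • e) ∂I := by
      rw [intervalIntegral.integral_of_le hsx.le, integral_Ioc_eq_integral_Ioo]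
      refine (enorm_integral_le_lintegral_enorm _).trans ?_
      refine le_trans ?_ (lintegral_mono_set (Set.Ioo_subset_Ioo_right (hsb x hx)))
      refine setLIntegral_mono' measurableSet_Ioo fun t ht => ?_
      have hmem : x - t • e ∈ S := by
        refine ⟨hin t ⟨ht.1.le, ht.2⟩, ?_⟩
        have h1 : x - s x • e ∈ Ωᶜ := by
          rw [hΩ.frontier_eq] at hfr; exact hfr.2
        refine (Metric.infDist_le_dist_of_mem h1).trans_lt ?_
        have : (x - t • e) - (x - s x • e) = (s x - t) • e := by rw [sub_smul]; abel
        rw [dist_eq_norm, this, norm_smul, he, mul_one, Real.norm_of_nonneg (by linarith [ht.2])]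
        linarith [hsb x hx, ht.1]
      rw [hg, Set.indicator_of_mem hmem, enorm_neg, ← ofReal_norm, ← ofReal_norm, norm_gradient_eq]
      apply ENNReal.ofReal_le_ofReal
      simpa [he] using (fderiv ℝ f (x - t • e)).le_opNorm e
    calc ‖f x‖ₑ = ‖f (x - s x • e) - ∫ t in (0 : ℝ)..(s x), -(fderiv ℝ f (x - t • e) e)‖ₑ := by
          rw [← hfx]
      _ ≤ _ := enorm_sub_le
      _ ≤ _ := by gcongr
  have hpt2 : ∀ x ∈ A, ‖f x‖ₑ ^ 2 ≤ 2 * ‖f (x - s x • e)‖ₑ ^ 2 +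
      2 * ENNReal.ofReal b * ∫⁻ t, g (x - t • e) ^ 2 ∂I := by
    intro x hx
    have hm : Measurable fun t : ℝ => g (x - t • e) := hgm.comp (by fun_prop)
    have h1 := lintegral_sq_le I hm.aemeasurable
    rw [hIu] at h1
    calc ‖f x‖ₑ ^ 2 ≤ (‖f (x - s x • e)‖ₑ + ∫⁻ t, g (x - t • e) ∂I) ^ 2 := by
          gcongr; exact hpt x hx
      _ ≤ _ := ENNReal.add_sq_le_two_mul _ _
      _ ≤ _ := by rw [mul_assoc 2 (ENNReal.ofReal b)]; gcongr
  have hfc := hf.continuous.measurable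
  have hm2 : Measurable fun q : RSpace n × ℝ => g (q.1 - q.2 • e) ^ 2 :=
    (hgm.comp (by fun_prop)).pow_const 2
  calc ∫⁻ x in A, ‖f x‖ₑ ^ 2
      ≤ ∫⁻ x in A, (2 * ‖f (x - s x • e)‖ₑ ^ 2 +
        2 * ENNReal.ofReal b * ∫⁻ t, g (x - t • e) ^ 2 ∂I) := setLIntegral_mono' hA hpt2
    _ = 2 * (∫⁻ x in A, ‖f (x - s x • e)‖ₑ ^ 2) +
        2 * ENNReal.ofReal b * ∫⁻ x in A, ∫⁻ t, g (x - t • e) ^ 2 ∂I := by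
      have hm1 : Measurable fun x => ‖f (x - s x • e)‖ₑ ^ 2 :=
        ((hfc.comp (measurable_id.sub (hs.smul_const e))).enorm).pow_const 2
      rw [lintegral_add_left (hm1.const_mul 2), lintegral_const_mul _ hm1,
        lintegral_const_mul _ hm2.lintegral_prod_right']
    _ ≤ _ := by
      rw [pow_two (ENNReal.ofReal b), ← mul_assoc, mul_assoc (2 * ENNReal.ofReal b) (ENNReal.ofReal b)]
      refine add_le_add_right (mul_le_mul_right ?_ _) _
      calc ∫⁻ x in A, ∫⁻ t, g (x - t • e) ^ 2 ∂I ≤ ∫⁻ x, ∫⁻ t, g (x - t • e) ^ 2 ∂I :=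
            setLIntegral_le_lintegral _ _
        _ = ∫⁻ t, (∫⁻ x, g (x - t • e) ^ 2) ∂I := lintegral_lintegral_swap hm2.aemeasurable
        _ = ∫⁻ _, (∫⁻ x, g x ^ 2) ∂I := by
          refine lintegral_congr fun t => ?_
          exact lintegral_sub_right_eq_self (fun x => g x ^ 2) (t • e)
        _ = ENNReal.ofReal b * ∫⁻ x in S, ‖gradient f x‖ₑ ^ 2 := by
          rw [lintegral_const, hIu, mul_comm, ← lintegral_indicator hSm]
          congr 1
          refine lintegral_congr fun x => ?_
          by_cases hx : x ∈ S <;> simp [hg, hx]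

theorem strip_mono (Ω : Set (RSpace n)) {δ δ' : ℝ} (h : δ ≤ δ') : strip Ω δ ⊆ strip Ω δ' :=
  fun _ hx => ⟨hx.1, hx.2.trans_le h⟩

theorem IsSmoothApprox.tendsto_expNegInvGlue {Ω : Set (RSpace n)} {u : RSpace n → ℝ}
    {H : RSpace n → RSpace n} {h : ℕ → RSpace n → ℝ} (A : IsSmoothApprox Ω u H h) :
    ∀ᵐ x ∂(volume.restrict Ω), Tendsto (fun k => expNegInvGlue (h k x)) atTop
      (𝓝 (expNegInvGlue (u x))) := by
  filter_upwards [A.tendsto_ae] with x hx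
  exact (expNegInvGlue.continuous.tendsto _).comp hx

theorem eLpNorm_two_sq_eq {α E : Type*} [MeasurableSpace α] [NormedAddCommGroup E] {μ : Measure α}
    (f : α → E) : eLpNorm f 2 μ ^ 2 = ∫⁻ x, ‖f x‖ₑ ^ 2 ∂μ := by
  have := eLpNorm_nnreal_pow_eq_lintegral (μ := μ) (f := f) (p := 2) (by norm_num)
  norm_num at this
  exact this

/-- The strip inequality is applied to the smooth functions `T(h k)` and passed to the limit.
Boundary convergence enters only through null sets: an exceptional set on the frontier has a null
cylinder over it in the direction `e`, and bounded convergence removes the boundary term. The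
constant is `8 = 2 · 4`, with `4` from `T' ≤ 2`. -/
theorem IsSmoothApprox.lintegral_strip_le {Ω : Set (RSpace n)} (hn : 1 ≤ n)
    (hΩ : IsBoundedLipschitzDomain Ω) {u : RSpace n → ℝ}
    {H : RSpace n → RSpace n} {h : ℕ → RSpace n → ℝ} (A : IsSmoothApprox Ω u H h)
    (hbd : ∀ᵐ y ∂(surfaceMeasure Ω), Tendsto (fun k => expNegInvGlue (h k y)) atTop (𝓝 0))
    {p : RSpace n} (hp : p ∈ frontier Ω) :
    ∃ ρ K : ℝ, 0 < ρ ∧ 1 ≤ K ∧ ∀ δ ≤ ρ,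
      ∫⁻ x in strip Ω δ ∩ Metric.ball p ρ, ‖expNegInvGlue (u x)‖ₑ ^ 2 ≤
        8 * ENNReal.ofReal (K * δ) ^ 2 * ∫⁻ x in strip Ω (K * δ), ‖H x‖ₑ ^ 2 := by
  obtain ⟨e, s, ρ, K, he, hρ, hK, hsc, hchart, hdist⟩ := hΩ.lipschitz.exists_chart hΩ.isOpen hp
  refine ⟨ρ, K, hρ, hK, fun δ hδ => ?_⟩
  set B := strip Ω δ ∩ Metric.ball p ρ with hB
  have hBo : IsOpen B := (isOpen_strip hΩ.isOpen δ).inter Metric.isOpen_ball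
  have hBΩ : B ⊆ Ω := Set.inter_subset_left.trans (strip_subset Ω δ)
  set S := strip Ω (K * δ) with hS
  have hSΩ : S ⊆ Ω := strip_subset Ω _
  set b := ENNReal.ofReal (K * δ) with hb
  have hchartB : ∀ x ∈ B, 0 < s x ∧ x - s x • e ∈ frontier Ω ∧
      ∀ t ∈ Set.Ico 0 (s x), x - t • e ∈ Ω := fun x hx => hchart x ⟨hBΩ hx, hx.2⟩
  have hsb : ∀ x ∈ B, s x ≤ K * δ := fun x hx => hdist x ⟨hBΩ hx, hx.2⟩ δ hδ hx.1.2
  have hTs : ∀ k, ContDiff ℝ (⊤ : ℕ∞) fun x => expNegInvGlue (h k x) := fun k =>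
    expNegInvGlue.contDiff.comp (A.contDiff k)
  -- the boundary term tends to zero
  have hfoot : ∀ᵐ x ∂(volume.restrict B),
      Tendsto (fun k => expNegInvGlue (h k (x - s x • e))) atTop (𝓝 0) := by
    rw [ae_iff, surfaceMeasure, Measure.restrict_apply₀'
      isClosed_frontier.measurableSet.nullMeasurableSet] at hbd
    have h0 := volume_perp_preimage_eq_zero hn he hbd
    rw [ae_restrict_iff' hBo.measurableSet, ae_iff]
    refine measure_mono_null (fun x hx => ?_) h0
    simp only [Set.mem_ofPred_eq, Classical.not_imp] at hx
    exact ⟨x - s x • e, ⟨hx.2, (hchartB x hx.1).2.1⟩, (perp_sub_smul he x _).symm⟩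
  have hBfin : volume B ≠ ⊤ := (hΩ.isBounded.subset hBΩ).measure_lt_top.ne
  have ha : Tendsto (fun k => ∫⁻ x in B, ‖expNegInvGlue (h k (x - s x • e))‖ₑ ^ 2) atTop
      (𝓝 0) := by
    have := tendsto_lintegral_of_dominated_convergence (μ := volume.restrict B)
      (F := fun k x => ‖expNegInvGlue (h k (x - s x • e))‖ₑ ^ 2) (f := fun _ => 0) (fun _ => 1)
      (fun k => ?_) (fun k => Eventually.of_forall fun x => ?_) (by simpa using hBfin) ?_
    · simpa using this
    · have hc : Continuous fun x => x - s x • e := by fun_prop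
      exact (((hTs k).continuous.comp hc).measurable.enorm).pow_const 2
    · dsimp only
      rw [Real.enorm_of_nonneg (expNegInvGlue.nonneg _)]
      exact pow_le_one' (ENNReal.ofReal_le_one.2 (expNegInvGlue.le_one _)) 2
    · filter_upwards [hfoot] with x hx
      have h1 := (ENNReal.continuous_pow 2).continuousAt.tendsto.comp
        (continuous_enorm.continuousAt.tendsto.comp hx)
      simpa [Function.comp_def] using h1
  have hc : ∀ k, ∫⁻ x in S, ‖gradient (fun y => expNegInvGlue (h k y)) x‖ₑ ^ 2 ≤
      4 * (eLpNorm (fun x => gradient (h k) x - H x) 2 (volume.restrict Ω) +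
        eLpNorm H 2 (volume.restrict S)) ^ 2 := by
    intro k
    have hH := A.memLp_gradient.1.mono_measure (Measure.restrict_mono hSΩ le_rfl)
    have h1 : eLpNorm (gradient (h k)) 2 (volume.restrict S) ≤
        eLpNorm (fun x => gradient (h k) x - H x) 2 (volume.restrict Ω) +
        eLpNorm H 2 (volume.restrict S) := by
      calc eLpNorm (gradient (h k)) 2 (volume.restrict S)
          = eLpNorm ((fun x => gradient (h k) x - H x) + H) 2 (volume.restrict S) := by
            congr 1; ext1 x; simp
        _ ≤ _ := eLpNorm_add_le
            ((A.contDiff k).continuous_gradient.aestronglyMeasurable.sub hH) hH one_le_two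
        _ ≤ _ := by
            gcongr
    calc ∫⁻ x in S, ‖gradient (fun y => expNegInvGlue (h k y)) x‖ₑ ^ 2
        ≤ ∫⁻ x in S, 4 * ‖gradient (h k) x‖ₑ ^ 2 := by
          refine lintegral_mono fun x => ?_
          rw [gradient_comp ((A.contDiff k).differentiable (by simp) x)
            (expNegInvGlue.hasDerivAt _), enorm_smul, mul_pow]
          gcongr
          rw [Real.enorm_of_nonneg (expNegInvGlue.deriv_nonneg _),
            ← ENNReal.ofReal_pow (expNegInvGlue.deriv_nonneg _)]
          refine ENNReal.ofReal_le_of_le_toReal ?_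
          have := expNegInvGlue.deriv_le_two (h k x)
          have := expNegInvGlue.deriv_nonneg (h k x)
          simp only [ENNReal.toReal_ofNat]
          nlinarith
      _ = 4 * eLpNorm (gradient (h k)) 2 (volume.restrict S) ^ 2 := by
          rw [eLpNorm_two_sq_eq, lintegral_const_mul' _ _ (by simp)]
      _ ≤ _ := by gcongr
  have hlim : Tendsto (fun k => 2 * (∫⁻ x in B, ‖expNegInvGlue (h k (x - s x • e))‖ₑ ^ 2) +
      2 * b ^ 2 * (4 * (eLpNorm (fun x => gradient (h k) x - H x) 2 (volume.restrict Ω) +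
        eLpNorm H 2 (volume.restrict S)) ^ 2)) atTop
      (𝓝 (2 * 0 + 2 * b ^ 2 * (4 * (0 + eLpNorm H 2 (volume.restrict S)) ^ 2))) := by
    refine (ENNReal.Tendsto.const_mul ha (by simp)).add
      (ENNReal.Tendsto.const_mul (ENNReal.Tendsto.const_mul ?_ (by simp))
        (Or.inr (by finiteness)))
    exact ((ENNReal.continuous_pow 2).tendsto _).comp
      (A.tendsto_gradient.add tendsto_const_nhds)
  -- Fatou's lemma on the left; on the right the boundary term vanishes and the gradients converge
  -- in `L²`.
  calc ∫⁻ x in B, ‖expNegInvGlue (u x)‖ₑ ^ 2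
      = ∫⁻ x in B, liminf (fun k => ‖expNegInvGlue (h k x)‖ₑ ^ 2) atTop := by
        refine lintegral_congr_ae ?_
        filter_upwards [ae_restrict_of_ae_restrict_of_subset hBΩ A.tendsto_expNegInvGlue] with x hx
        exact ((((ENNReal.continuous_pow 2).comp continuous_enorm).tendsto _).comp hx).liminf_eq.symm
    _ ≤ liminf (fun k => ∫⁻ x in B, ‖expNegInvGlue (h k x)‖ₑ ^ 2) atTop :=
        lintegral_liminf_le fun k => ((hTs k).continuous.measurable.enorm).pow_const 2
    _ ≤ liminf (fun k => 2 * (∫⁻ x in B, ‖expNegInvGlue (h k (x - s x • e))‖ₑ ^ 2) +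
      2 * b ^ 2 * (4 * (eLpNorm (fun x => gradient (h k) x - H x) 2 (volume.restrict Ω) +
        eLpNorm H 2 (volume.restrict S)) ^ 2)) atTop := by
        refine liminf_le_liminf (Eventually.of_forall fun k => ?_)
        refine (lintegral_strip_sq_le hΩ.isOpen he hBo.measurableSet hsc.measurable hchartB hsb
          (hTs k)).trans ?_
        gcongr
        exact hc k
    _ = 8 * b ^ 2 * ∫⁻ x in S, ‖H x‖ₑ ^ 2 := by
        rw [hlim.liminf_eq, ← eLpNorm_two_sq_eq]
        simp only [mul_zero, zero_add]
        ring

/-- Compactness of the frontier merges the local estimates, with the smaller radius, the larger `K`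
and the sum of the constants. The open set so obtained contains a thickening of the frontier, hence
every sufficiently thin strip. -/
theorem IsSmoothApprox.exists_lintegral_strip_le {Ω : Set (RSpace n)} (hn : 1 ≤ n)
    (hΩ : IsBoundedLipschitzDomain Ω) {u : RSpace n → ℝ}
    {H : RSpace n → RSpace n} {h : ℕ → RSpace n → ℝ} (A : IsSmoothApprox Ω u H h)
    (hbd : ∀ᵐ y ∂(surfaceMeasure Ω), Tendsto (fun k => expNegInvGlue (h k y)) atTop (𝓝 0)) :
    ∃ (ρ K : ℝ) (C : NNReal), 0 < ρ ∧ 1 ≤ K ∧ ∀ δ, 0 < δ → δ ≤ ρ →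
      ∫⁻ x in strip Ω δ, ‖expNegInvGlue (u x)‖ₑ ^ 2 ≤
        C * ENNReal.ofReal δ ^ 2 * ∫⁻ x in strip Ω (K * δ), ‖H x‖ₑ ^ 2 := by
  have hcpt : IsCompact (frontier Ω) := Metric.isCompact_of_isClosed_isBounded isClosed_frontier
    (hΩ.isBounded.closure.subset frontier_subset_closure)
  have key : ∃ O, IsOpen O ∧ frontier Ω ⊆ O ∧ ∃ (ρ K : ℝ) (C : NNReal), 0 < ρ ∧ 1 ≤ K ∧
      ∀ δ, 0 < δ → δ ≤ ρ → ∫⁻ x in strip Ω δ ∩ O, ‖expNegInvGlue (u x)‖ₑ ^ 2 ≤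
        C * ENNReal.ofReal δ ^ 2 * ∫⁻ x in strip Ω (K * δ), ‖H x‖ₑ ^ 2 := by
    refine hcpt.induction_on (p := fun V => ∃ O, IsOpen O ∧ V ⊆ O ∧ ∃ (ρ K : ℝ) (C : NNReal),
      0 < ρ ∧ 1 ≤ K ∧ ∀ δ, 0 < δ → δ ≤ ρ → ∫⁻ x in strip Ω δ ∩ O, ‖expNegInvGlue (u x)‖ₑ ^ 2 ≤
        C * ENNReal.ofReal δ ^ 2 * ∫⁻ x in strip Ω (K * δ), ‖H x‖ₑ ^ 2) ?_ ?_ ?_ ?_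
    · exact ⟨∅, isOpen_empty, subset_rfl, 1, 1, 0, one_pos, le_rfl, by simp⟩
    · rintro s t hst ⟨O, hO, htO, hh⟩
      exact ⟨O, hO, hst.trans htO, hh⟩
    · rintro s t ⟨O, hO, hsO, ρ, K, C, hρ, hK, hh⟩ ⟨O', hO', hsO', ρ', K', C', hρ', hK', hh'⟩
      refine ⟨O ∪ O', hO.union hO', Set.union_subset_union hsO hsO', min ρ ρ', max K K', C + C',
        lt_min hρ hρ', hK.trans (le_max_left _ _), fun δ hδ hδρ => ?_⟩
      have e1 : strip Ω (K * δ) ⊆ strip Ω (max K K' * δ) :=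
        strip_mono Ω (mul_le_mul_of_nonneg_right (le_max_left _ _) hδ.le)
      have e2 : strip Ω (K' * δ) ⊆ strip Ω (max K K' * δ) :=
        strip_mono Ω (mul_le_mul_of_nonneg_right (le_max_right _ _) hδ.le)
      rw [Set.inter_union_distrib_left]
      refine (lintegral_union_le _ _ _).trans ?_
      calc _ ≤ _ := add_le_add (hh δ hδ (hδρ.trans (min_le_left _ _)))
            (hh' δ hδ (hδρ.trans (min_le_right _ _)))
        _ ≤ C * ENNReal.ofReal δ ^ 2 * (∫⁻ x in strip Ω (max K K' * δ), ‖H x‖ₑ ^ 2) +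
            C' * ENNReal.ofReal δ ^ 2 * (∫⁻ x in strip Ω (max K K' * δ), ‖H x‖ₑ ^ 2) :=
          add_le_add (mul_le_mul_right (lintegral_mono_set e1) _)
            (mul_le_mul_right (lintegral_mono_set e2) _)
        _ = _ := by push_cast; ring
    · intro p hp
      obtain ⟨ρ, K, hρ, hK, hh⟩ := A.lintegral_strip_le hn hΩ hbd hp
      refine ⟨Metric.ball p ρ, mem_nhdsWithin_of_mem_nhds (Metric.ball_mem_nhds p hρ),
        Metric.ball p ρ, Metric.isOpen_ball, subset_rfl, ρ, K, 8 * (K.toNNReal) ^ 2, hρ, hK,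
        fun δ _ hδ => (hh δ hδ).trans_eq ?_⟩
      rw [ENNReal.ofReal_mul (by linarith)]
      push_cast
      rw [mul_pow, ← mul_assoc]
      rfl
  obtain ⟨O, hO, hfO, ρ, K, C, hρ, hK, hh⟩ := key
  obtain ⟨r, hr, hrO⟩ := hcpt.exists_thickening_subset_open hO hfO
  have hne : Ω ≠ Set.univ := by
    rintro rfl
    have : Nonempty (Fin n) := ⟨⟨0, hn⟩⟩
    exact NormedSpace.unbounded_univ ℝ (RSpace n) hΩ.isBounded
  refine ⟨min ρ r, K, C, lt_min hρ hr, hK, fun δ hδ hδρ => ?_⟩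
  have hsub : strip Ω δ ⊆ O := fun x hx => by
    obtain ⟨y, hy, hxy⟩ := exists_mem_frontier_infDist_compl_eq_dist hx.1 hne
    refine hrO (Metric.mem_thickening_iff.2 ⟨y, hy, ?_⟩)
    rw [← hxy]
    exact hx.2.trans_le (hδρ.trans (min_le_right _ _))
  have := hh δ hδ (hδρ.trans (min_le_left _ _))
  rwa [Set.inter_eq_left.2 hsub] at this

/-! ### Cutoffs and the two comparison principles -/

/-- Mollified cutoff functions for a bounded open set. -/
theorem exists_cutoff {Ω : Set (RSpace n)} (hΩb : Bornology.IsBounded Ω) {δ : ℝ} (hδ : 0 < δ) :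
    ∃ χ : RSpace n → ℝ, IsTestFunction Ω χ ∧ (∀ x, 0 ≤ χ x) ∧
      (∀ x, δ ≤ Metric.infDist x Ωᶜ → χ x = 1 ∧ gradient χ x = 0) ∧
      ∀ x, ‖gradient χ x‖ ≤ 4 / δ := by
  set d : RSpace n → ℝ := fun x => Metric.infDist x Ωᶜ with hd
  have hdl : ∀ x y, d x ≤ d y + dist x y := fun x y => Metric.infDist_le_infDist_add_dist
  -- A `4 / δ`-Lipschitz ramp in the distance `d` to the complement, zero for `d ≤ δ / 4` and one
  -- for `d ≥ δ / 2`. Mollifying at scale `δ / 8` leaves a margin on both sides, and a kernel of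
  -- mass one preserves the Lipschitz constant.
  set η : RSpace n → ℝ := fun x => min 1 (max 0 (4 / δ * d x - 1)) with hη
  have hηc : Continuous η := by
    have : Continuous d := Metric.continuous_infDist_pt _
    fun_prop
  have hη0 : ∀ x, 0 ≤ η x := fun x => le_min zero_le_one (le_max_left _ _)
  have hηl : ∀ x y, |η x - η y| ≤ 4 / δ * dist x y := by
    intro x y
    have h1 : |d x - d y| ≤ dist x y := by
      rw [abs_sub_le_iff]
      have := hdl x y
      have := hdl y x
      rw [dist_comm y x] at this
      constructor <;> linarith
    calc |η x - η y| ≤ |max 0 (4 / δ * d x - 1) - max 0 (4 / δ * d y - 1)| := by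
          simpa using abs_min_sub_min_le_max 1 (max 0 (4 / δ * d x - 1)) 1 (max 0 (4 / δ * d y - 1))
      _ ≤ |(4 / δ * d x - 1) - (4 / δ * d y - 1)| := by
          simpa using abs_max_sub_max_le_max 0 (4 / δ * d x - 1) 0 (4 / δ * d y - 1)
      _ = 4 / δ * |d x - d y| := by
          rw [← abs_of_pos (show 0 < 4 / δ by positivity), ← abs_mul, abs_of_pos (show 0 < 4 / δ by positivity)]
          congr 1; ring
      _ ≤ _ := by gcongr
  let φ : ContDiffBump (0 : RSpace n) := ⟨δ / 16, δ / 8, by positivity, by linarith⟩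
  set w : RSpace n → ℝ := φ.normed volume with hw
  have hwc : Continuous w := φ.continuous_normed
  have hwcs : HasCompactSupport w := φ.hasCompactSupport_normed
  have hw0 : ∀ x, 0 ≤ w x := φ.nonneg_normed
  have hwi : Integrable w := φ.integrable_normed
  have hw1 : ∫ x, w x = 1 := φ.integral_normed
  set χ : RSpace n → ℝ := convolution w η (ContinuousLinearMap.lsmul ℝ ℝ) volume with hχ
  have hχe : ∀ x, χ x = ∫ t, w t * η (x - t) := fun x => by
    rw [hχ, convolution_def]; simp
  have hint : ∀ x, Integrable fun t => w t * η (x - t) := fun x =>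
    (hwc.mul (hηc.comp (by fun_prop))).integrable_of_hasCompactSupport hwcs.mul_right
  have hsmooth : ContDiff ℝ (⊤ : ℕ∞) χ :=
    hwcs.contDiff_convolution_left _ φ.contDiff_normed hηc.locallyIntegrable
  have hone : ∀ x, 3 / 4 * δ ≤ d x → χ x = 1 := by
    intro x hx
    have hη1 : ∀ y, δ / 2 ≤ d y → η y = 1 := fun y hy => by
      apply min_eq_left
      refine le_max_of_le_right ?_
      have : 4 / δ * (δ / 2) ≤ 4 / δ * d y := by gcongr
      have h2 : 4 / δ * (δ / 2) = 2 := by field_simp; norm_num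
      linarith
    have hηx : η x = 1 := hη1 x (by linarith)
    rw [hχ, hw, ← hηx]
    apply ContDiffBump.normed_convolution_eq_right
    intro y hy
    rw [hηx]
    apply hη1
    have h1 : dist y x < δ / 8 := hy
    have := hdl x y
    rw [dist_comm] at this
    linarith
  have hzero : ∀ x, χ x ≠ 0 → δ / 8 ≤ d x := by
    intro x hx
    by_contra! hlt
    apply hx
    rw [hχe]
    refine integral_eq_zero_of_ae (Eventually.of_forall fun t => ?_)
    simp only [Pi.zero_apply, mul_eq_zero]
    by_cases ht : t ∈ Metric.ball (0 : RSpace n) (δ / 8)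
    · right
      have h1 := hdl (x - t) x
      have h2 : dist (x - t) x < δ / 8 := by simpa [dist_eq_norm] using ht
      have h3 : 4 / δ * d (x - t) ≤ 4 / δ * (δ / 4) := by gcongr; linarith
      have h4 : 4 / δ * (δ / 4) = 1 := by field_simp
      simp only [hη]
      rw [max_eq_left (by linarith)]
      simp
    · left
      have := φ.support_normed_eq (μ := volume)
      by_contra h0
      exact ht (this ▸ h0)
  have hts : tsupport χ ⊆ {x | δ / 8 ≤ d x} :=
    closure_minimal (fun x hx => hzero x hx)
      (isClosed_le continuous_const (Metric.continuous_infDist_pt _))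
  have htsΩ : tsupport χ ⊆ Ω := fun x hx => by
    by_contra hxΩ
    have : d x = 0 := Metric.infDist_zero_of_mem (show x ∈ Ωᶜ from hxΩ)
    have h2 : δ / 8 ≤ d x := hts hx
    linarith
  refine ⟨χ, ⟨hsmooth, Metric.isCompact_of_isClosed_isBounded (isClosed_tsupport χ)
    (hΩb.subset htsΩ), htsΩ⟩, fun x => ?_, fun x hx => ⟨hone x (by linarith), ?_⟩, fun x => ?_⟩
  · rw [hχe]
    exact integral_nonneg fun t => mul_nonneg (hw0 t) (hη0 _)
  · have : χ =ᶠ[𝓝 x] fun _ => 1 := by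
      have h1 : ∀ᶠ y in 𝓝 x, 3 / 4 * δ < d y :=
        continuousAt_const.eventually_lt (Metric.continuous_infDist_pt _).continuousAt
          (by linarith)
      exact h1.mono fun y hy => hone y hy.le
    rw [this.gradient_eq, gradient_fun_const]
  · rw [norm_gradient_eq]
    have hl : LipschitzWith (Real.toNNReal (4 / δ)) χ := by
      refine LipschitzWith.of_dist_le_mul fun x y => ?_
      rw [Real.coe_toNNReal _ (by positivity), Real.dist_eq, hχe, hχe,
        ← integral_sub (hint x) (hint y)]
      refine (abs_integral_le_integral_abs).trans ?_
      calc ∫ t, |w t * η (x - t) - w t * η (y - t)| ≤ ∫ t, w t * (4 / δ * dist x y) := by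
            refine integral_mono ((hint x).sub (hint y)).abs (hwi.mul_const _) fun t => ?_
            simp only [← mul_sub, abs_mul, abs_of_nonneg (hw0 t)]
            have := hηl (x - t) (y - t)
            rw [dist_sub_right] at this
            exact mul_le_mul_of_nonneg_left this (hw0 t)
        _ = _ := by rw [integral_mul_const, hw1, one_mul]
    have := norm_fderiv_le_of_lipschitz ℝ hl (x₀ := x)
    rwa [Real.coe_toNNReal _ (by positivity)] at this

theorem IsSmoothApprox.aestronglyMeasurable {Ω : Set (RSpace n)} {u : RSpace n → ℝ}
    {H : RSpace n → RSpace n} {h : ℕ → RSpace n → ℝ} (A : IsSmoothApprox Ω u H h) :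
    AEStronglyMeasurable u (volume.restrict Ω) :=
  aestronglyMeasurable_of_tendsto_ae atTop
    (fun k => (A.contDiff k).continuous.aestronglyMeasurable) A.tendsto_ae

theorem IsSmoothApprox.integrable_mul {Ω : Set (RSpace n)} {u f : RSpace n → ℝ}
    {H : RSpace n → RSpace n} {h : ℕ → RSpace n → ℝ} (A : IsSmoothApprox Ω u H h)
    (hΩ : Bornology.IsBounded Ω) (hf : MemLp f 2 (volume.restrict Ω)) {χ : RSpace n → ℝ}
    (hχ : IsTestFunction Ω χ) :
    Integrable (fun x => χ x * expNegInvGlue (u x) * f x) (volume.restrict Ω) := by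
  have : IsFiniteMeasure (volume.restrict Ω) := ⟨by
    rw [Measure.restrict_apply_univ]; exact hΩ.measure_lt_top⟩
  obtain ⟨B, hB⟩ := hχ.exists_bound
  refine (hf.integrable one_le_two).bdd_mul (c := B)
    (hχ.smooth.continuous.aestronglyMeasurable.mul
      (expNegInvGlue.continuous.comp_aestronglyMeasurable A.aestronglyMeasurable))
    (Eventually.of_forall fun x => ?_)
  rw [norm_mul, Real.norm_of_nonneg (expNegInvGlue.nonneg _)]
  calc |χ x| * expNegInvGlue (u x) ≤ |χ x| * 1 := by gcongr; exact expNegInvGlue.le_one _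
    _ ≤ B := by rw [mul_one]; exact hB x

/-- A comparison principle away from the boundary: `u` vanishes where the cutoff varies. -/
theorem IsSmoothApprox.nonpos_of_cutoff {Ω : Set (RSpace n)} {u f : RSpace n → ℝ}
    {H : RSpace n → RSpace n} {h : ℕ → RSpace n → ℝ} (A : IsSmoothApprox Ω u H h)
    (hΩ : Bornology.IsBounded Ω) (hf : MemLp f 2 (volume.restrict Ω))
    (heq : ∀ ψ, IsTestFunction Ω ψ → ∫ x in Ω, (inner ℝ (H x) (gradient ψ x) + f x * ψ x) = 0)
    {χ : RSpace n → ℝ} (hχ : IsTestFunction Ω χ) (hχ0 : ∀ x, 0 ≤ χ x)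
    (hgrad : ∀ᵐ x ∂(volume.restrict Ω), u x ≤ 0 ∨ gradient χ x = 0)
    (hpos : ∀ᵐ x ∂(volume.restrict Ω), 0 < χ x → 0 < u x → 0 < f x) :
    ∀ᵐ x ∂(volume.restrict Ω), 0 < χ x → u x ≤ 0 := by
  have h1 := integral_mul_expNegInvGlue_le A hΩ hf heq hχ hχ0
  have h2 : ∫ x in Ω, expNegInvGlue (u x) * inner ℝ (H x) (gradient χ x) = 0 := by
    refine integral_eq_zero_of_ae ?_
    filter_upwards [hgrad] with x hx
    rcases hx with hx | hx
    · simp [expNegInvGlue.zero_of_nonpos hx]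
    · simp [hx]
  rw [h2, neg_zero] at h1
  -- The integrand is nonnegative and has nonpositive integral, so it vanishes almost everywhere;
  -- where `χ > 0` and `u > 0` it would be strictly positive.
  have h3 : 0 ≤ᵐ[volume.restrict Ω] fun x => χ x * expNegInvGlue (u x) * f x := by
    filter_upwards [hpos] with x hx
    rcases (hχ0 x).eq_or_lt with h0 | h0
    · simp [← h0]
    · rcases le_or_gt (u x) 0 with hu | hu
      · simp [expNegInvGlue.zero_of_nonpos hu]
      · exact mul_nonneg (mul_nonneg (hχ0 x) (expNegInvGlue.nonneg _)) (hx h0 hu).le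
  have h4 := (integral_eq_zero_iff_of_nonneg_ae h3 (A.integrable_mul hΩ hf hχ)).1
    (le_antisymm h1 (integral_nonneg_of_ae h3))
  filter_upwards [h4, hpos] with x hx hp hχx
  by_contra! hu
  have := mul_pos (mul_pos hχx (expNegInvGlue.pos_of_pos hu)) (hp hχx hu)
  exact this.ne' hx

/-- The strips decrease to the empty set inside a set of finite volume, so absolute continuity of
the integral applies. -/
theorem tendsto_lintegral_strip {Ω : Set (RSpace n)} (hΩ : IsOpen Ω)
    (hne : (Ωᶜ).Nonempty) (hb : Bornology.IsBounded Ω) {g : RSpace n → ENNReal}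
    (hg : ∫⁻ x in Ω, g x ≠ ⊤) {δ : ℕ → ℝ} (hδ : Antitone δ) (hlim : Tendsto δ atTop (𝓝 0)) :
    Tendsto (fun m => ∫⁻ x in strip Ω (δ m), g x) atTop (𝓝 0) := by
  have h1 : Tendsto (fun m => volume (strip Ω (δ m))) atTop (𝓝 0) := by
    have h2 : ⋂ m, strip Ω (δ m) = ∅ := by
      refine Set.eq_empty_iff_forall_notMem.2 fun x hx => ?_
      rw [Set.mem_iInter] at hx
      have hxΩ := (hx 0).1
      have hpos : 0 < Metric.infDist x Ωᶜ :=
        (hΩ.isClosed_compl.notMem_iff_infDist_pos hne).1 (by simpa using hxΩ)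
      obtain ⟨m, hm⟩ := (hlim.eventually_lt_const hpos).exists
      exact absurd (hx m).2 (not_lt.2 hm.le)
    have := tendsto_measure_iInter_atTop (μ := volume) (s := fun m => strip Ω (δ m))
      (fun m => (isOpen_strip hΩ _).measurableSet.nullMeasurableSet)
      (fun i j hij => strip_mono Ω (hδ hij))
      ⟨0, (hb.subset (strip_subset Ω _)).measure_lt_top.ne⟩
    rwa [h2, measure_empty] at this
  have h3 : Tendsto (fun m => (volume.restrict Ω) (strip Ω (δ m))) atTop (𝓝 0) :=
    tendsto_of_tendsto_of_tendsto_of_le_of_le tendsto_const_nhds h1 (fun _ => zero_le)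
      fun _ => Measure.restrict_apply_le _ _
  have h4 := tendsto_setLIntegral_zero hg h3
  refine h4.congr fun m => ?_
  rw [Measure.restrict_restrict (isOpen_strip hΩ _).measurableSet,
    Set.inter_eq_left.2 (strip_subset Ω _)]

/-- The weak maximum principle for functions with vanishing positive part on the boundary. -/
theorem IsSmoothApprox.nonpos_of_boundary {Ω : Set (RSpace n)} (hn : 1 ≤ n)
    (hΩ : IsBoundedLipschitzDomain Ω) {u f : RSpace n → ℝ}
    {H : RSpace n → RSpace n} {h : ℕ → RSpace n → ℝ} (A : IsSmoothApprox Ω u H h)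
    (hbd : ∀ᵐ y ∂(surfaceMeasure Ω), Tendsto (fun k => expNegInvGlue (h k y)) atTop (𝓝 0))
    (hf : MemLp f 2 (volume.restrict Ω))
    (heq : ∀ ψ, IsTestFunction Ω ψ → ∫ x in Ω, (inner ℝ (H x) (gradient ψ x) + f x * ψ x) = 0)
    (hpos : ∀ᵐ x ∂(volume.restrict Ω), 0 < u x → 0 < f x) :
    ∀ᵐ x ∂(volume.restrict Ω), u x ≤ 0 := by
  obtain ⟨ρ, K, C, hρ, hK, hstrip⟩ := A.exists_lintegral_strip_le hn hΩ hbd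
  have hne : (Ωᶜ).Nonempty := by
    rw [Set.nonempty_compl]
    rintro rfl
    have : Nonempty (Fin n) := ⟨⟨0, hn⟩⟩
    exact NormedSpace.unbounded_univ ℝ (RSpace n) hΩ.isBounded
  set δ : ℕ → ℝ := fun m => ρ / (m + 1) with hδ
  have hδ0 : ∀ m, 0 < δ m := fun m => by positivity
  have hδρ : ∀ m, δ m ≤ ρ := fun m => div_le_self hρ.le (by linarith [m.cast_nonneg (α := ℝ)])
  have hδanti : Antitone δ := fun i j hij => by
    simp only [hδ]; gcongr
  have hδlim : Tendsto δ atTop (𝓝 0) := by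
    have := (tendsto_one_div_add_atTop_nhds_zero_nat (𝕜 := ℝ)).const_mul ρ
    simpa [hδ, div_eq_mul_inv] using this
  choose χ hχ hχ0 hχ1 hχg using fun m => exists_cutoff hΩ.isBounded (hδ0 m)
  have hE : ∫⁻ x in Ω, ‖H x‖ₑ ^ 2 ≠ ⊤ := by
    rw [← eLpNorm_two_sq_eq]
    exact ENNReal.pow_ne_top A.memLp_gradient.2.ne
  have hfT : ∀ᵐ x ∂(volume.restrict Ω), 0 ≤ expNegInvGlue (u x) * f x := by
    filter_upwards [hpos] with x hx
    rcases le_or_gt (u x) 0 with hu | hu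
    · simp [expNegInvGlue.zero_of_nonpos hu]
    · exact mul_nonneg (expNegInvGlue.nonneg _) (hx hu).le
  -- The error term is split by `ab ≤ a² + b²` with `a = (4 / δ) T(u)` and `b = |H|`. The strip
  -- inequality contributes `δ²`, which cancels `(4 / δ)²` up to the factor `16`.
  have hbound : ∀ m, ∫⁻ x in Ω, ENNReal.ofReal (χ m x * expNegInvGlue (u x) * f x) ≤
      (16 * C + 1) * ∫⁻ x in strip Ω (K * δ m), ‖H x‖ₑ ^ 2 := by
    intro m
    have hnn : 0 ≤ᵐ[volume.restrict Ω] fun x => χ m x * expNegInvGlue (u x) * f x := by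
      filter_upwards [hfT] with x hx
      rw [mul_assoc]
      exact mul_nonneg (hχ0 m x) hx
    rw [← ofReal_integral_eq_lintegral_ofReal (A.integrable_mul hΩ.isBounded hf (hχ m)) hnn]
    have h1 := integral_mul_expNegInvGlue_le A hΩ.isBounded hf heq (hχ m) (hχ0 m)
    have hSm := (isOpen_strip hΩ.isOpen (δ m)).measurableSet
    have hpt : ∀ x ∈ Ω, ‖expNegInvGlue (u x) * inner ℝ (H x) (gradient (χ m) x)‖ₑ ≤
        (strip Ω (δ m)).indicator (fun x => ENNReal.ofReal (4 / δ m) ^ 2 *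
          ‖expNegInvGlue (u x)‖ₑ ^ 2 + ‖H x‖ₑ ^ 2) x := by
      intro x hx
      by_cases hxs : x ∈ strip Ω (δ m)
      · rw [Set.indicator_of_mem hxs]
        have e1 : ‖(inner ℝ (H x) (gradient (χ m) x) : ℝ)‖ₑ ≤
            ‖H x‖ₑ * ENNReal.ofReal (4 / δ m) := by
          rw [← ofReal_norm, ← ofReal_norm, ← ENNReal.ofReal_mul (norm_nonneg _)]
          refine ENNReal.ofReal_le_ofReal ((norm_inner_le_norm _ _).trans ?_)
          gcongr
          exact hχg m x
        have hab : ∀ a b : ENNReal, a * b ≤ a ^ 2 + b ^ 2 := fun a b => by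
          rcases le_total a b with hab | hab
          · exact (mul_le_mul_left hab b).trans ((pow_two b).ge.trans le_add_self)
          · exact (mul_le_mul_right hab a).trans ((pow_two a).ge.trans le_self_add)
        calc _ = ‖expNegInvGlue (u x)‖ₑ * ‖(inner ℝ (H x) (gradient (χ m) x) : ℝ)‖ₑ := enorm_mul _ _
          _ ≤ ‖expNegInvGlue (u x)‖ₑ * (‖H x‖ₑ * ENNReal.ofReal (4 / δ m)) := by gcongr
          _ = (ENNReal.ofReal (4 / δ m) * ‖expNegInvGlue (u x)‖ₑ) * ‖H x‖ₑ := by ring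
          _ ≤ _ := hab _ _
          _ = _ := by rw [mul_pow]
      · have : δ m ≤ Metric.infDist x Ωᶜ := not_lt.1 fun h => hxs ⟨hx, h⟩
        simp [(hχ1 m x this).2]
    have hTm : AEMeasurable (fun x => ‖expNegInvGlue (u x)‖ₑ ^ 2)
        (volume.restrict (strip Ω (δ m))) :=
      ((expNegInvGlue.continuous.comp_aestronglyMeasurable
        (A.aestronglyMeasurable.mono_measure
          (Measure.restrict_mono (strip_subset Ω (δ m)) le_rfl))).enorm).pow_const 2
    calc ENNReal.ofReal (∫ x in Ω, χ m x * expNegInvGlue (u x) * f x)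
        ≤ ‖∫ x in Ω, expNegInvGlue (u x) * inner ℝ (H x) (gradient (χ m) x)‖ₑ := by
          rw [Real.enorm_eq_ofReal_abs]
          exact ENNReal.ofReal_le_ofReal (h1.trans (neg_le_abs _))
      _ ≤ ∫⁻ x in Ω, ‖expNegInvGlue (u x) * inner ℝ (H x) (gradient (χ m) x)‖ₑ :=
          enorm_integral_le_lintegral_enorm _
      _ ≤ ∫⁻ x in Ω, (strip Ω (δ m)).indicator (fun x => ENNReal.ofReal (4 / δ m) ^ 2 *
          ‖expNegInvGlue (u x)‖ₑ ^ 2 + ‖H x‖ₑ ^ 2) x :=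
          setLIntegral_mono' hΩ.isOpen.measurableSet hpt
      _ = ∫⁻ x in strip Ω (δ m), (ENNReal.ofReal (4 / δ m) ^ 2 *
          ‖expNegInvGlue (u x)‖ₑ ^ 2 + ‖H x‖ₑ ^ 2) := by
          rw [lintegral_indicator hSm, Measure.restrict_restrict hSm,
            Set.inter_eq_left.2 (strip_subset Ω _)]
      _ = ENNReal.ofReal (4 / δ m) ^ 2 * (∫⁻ x in strip Ω (δ m), ‖expNegInvGlue (u x)‖ₑ ^ 2) +
          ∫⁻ x in strip Ω (δ m), ‖H x‖ₑ ^ 2 := by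
          rw [lintegral_add_left' (hTm.const_mul _),
            lintegral_const_mul' _ _ (by finiteness)]
      _ ≤ ENNReal.ofReal (4 / δ m) ^ 2 * (C * ENNReal.ofReal (δ m) ^ 2 *
          ∫⁻ x in strip Ω (K * δ m), ‖H x‖ₑ ^ 2) + ∫⁻ x in strip Ω (K * δ m), ‖H x‖ₑ ^ 2 := by
          refine add_le_add (mul_le_mul_right (hstrip _ (hδ0 m) (hδρ m)) _)
            (lintegral_mono_set (strip_mono Ω ?_))
          exact le_mul_of_one_le_left (hδ0 m).le hK
      _ = (16 * C + 1) * ∫⁻ x in strip Ω (K * δ m), ‖H x‖ₑ ^ 2 := by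
          have h16 : ENNReal.ofReal (4 / δ m) ^ 2 * ENNReal.ofReal (δ m) ^ 2 = 16 := by
            rw [← mul_pow, ← ENNReal.ofReal_mul (by have := hδ0 m; positivity),
              div_mul_cancel₀ _ (hδ0 m).ne', ENNReal.ofReal_ofNat]
            norm_num
          rw [← h16]; ring
  have hlim : Tendsto (fun m => (16 * (C : ENNReal) + 1) *
      ∫⁻ x in strip Ω (K * δ m), ‖H x‖ₑ ^ 2) atTop (𝓝 0) := by
    have := ENNReal.Tendsto.const_mul (a := 16 * (C : ENNReal) + 1)
      (tendsto_lintegral_strip hΩ.isOpen hne hΩ.isBounded hE (δ := fun m => K * δ m)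
        (fun i j hij => mul_le_mul_of_nonneg_left (hδanti hij) (by linarith))
        (by simpa using hδlim.const_mul K)) (Or.inr (by finiteness))
    simpa using this
  -- At each point of `Ω` the cutoffs eventually equal `1`, so Fatou's lemma carries the bound to
  -- the full integral.
  have hzero : ∫⁻ x in Ω, ENNReal.ofReal (expNegInvGlue (u x) * f x) = 0 := by
    refine le_antisymm ?_ zero_le
    calc ∫⁻ x in Ω, ENNReal.ofReal (expNegInvGlue (u x) * f x)
        = ∫⁻ x in Ω, liminf (fun m => ENNReal.ofReal (χ m x * expNegInvGlue (u x) * f x)) atTop := by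
          refine setLIntegral_congr_fun hΩ.isOpen.measurableSet fun x hx => ?_
          have hp : 0 < Metric.infDist x Ωᶜ :=
            (hΩ.isOpen.isClosed_compl.notMem_iff_infDist_pos hne).1 (by simpa using hx)
          have : ∀ᶠ m in atTop, ENNReal.ofReal (expNegInvGlue (u x) * f x) =
              ENNReal.ofReal (χ m x * expNegInvGlue (u x) * f x) :=
            (hδlim.eventually_lt_const hp).mono fun m hm => by
              rw [(hχ1 m x hm.le).1, one_mul]
          exact (tendsto_const_nhds.congr' this).liminf_eq.symm
      _ ≤ liminf (fun m => ∫⁻ x in Ω, ENNReal.ofReal (χ m x * expNegInvGlue (u x) * f x)) atTop :=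
          lintegral_liminf_le' fun m =>
            (A.integrable_mul hΩ.isBounded hf (hχ m)).1.aemeasurable.ennreal_ofReal
      _ ≤ liminf (fun m => (16 * (C : ENNReal) + 1) *
          ∫⁻ x in strip Ω (K * δ m), ‖H x‖ₑ ^ 2) atTop :=
          liminf_le_liminf (Eventually.of_forall hbound)
      _ = 0 := hlim.liminf_eq
  have hm : AEMeasurable (fun x => ENNReal.ofReal (expNegInvGlue (u x) * f x))
      (volume.restrict Ω) :=
    ((expNegInvGlue.continuous.comp_aestronglyMeasurable A.aestronglyMeasurable).mul
      hf.1).aemeasurable.ennreal_ofReal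
  filter_upwards [(lintegral_eq_zero_iff' hm).1 hzero, hpos] with x hx hp
  by_contra! hu
  have := mul_pos (expNegInvGlue.pos_of_pos hu) (hp hu)
  simp only [Pi.zero_apply, ENNReal.ofReal_eq_zero] at hx
  linarith

/-! ### Weak solutions with traces and their smooth approximations -/

theorem MeasureTheory.MemLp.of_continuous_of_isBounded {F : Type*} [NormedAddCommGroup F]
    {Ω : Set (RSpace n)} (hΩ : IsOpen Ω)
    (hb : Bornology.IsBounded Ω) {f : RSpace n → F} (hf : Continuous f) {p : ENNReal} :
    MemLp f p (volume.restrict Ω) := by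
  have : IsFiniteMeasure (volume.restrict Ω) := ⟨by
    rw [Measure.restrict_apply_univ]; exact hb.measure_lt_top⟩
  obtain ⟨C, hC⟩ := hb.isCompact_closure.exists_bound_of_continuousOn hf.continuousOn
  exact MemLp.of_bound hf.aestronglyMeasurable C <|
    (ae_restrict_mem hΩ.measurableSet).mono fun x hx => hC x (subset_closure hx)

/-- Weak gradients are unique. -/
theorem HasH1Gradient.ae_eq {Ω : Set (RSpace n)} (hΩ : IsOpen Ω) (hb : Bornology.IsBounded Ω)
    {z : RSpace n → ℝ} {G G' : RSpace n → RSpace n} (h : HasH1Gradient Ω z G)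
    (h' : HasH1Gradient Ω z G') : G =ᵐ[volume.restrict Ω] G' := by
  have : IsFiniteMeasure (volume.restrict Ω) := ⟨by
    rw [Measure.restrict_apply_univ]; exact hb.measure_lt_top⟩
  have hG := h.memLp_gradient.integrable one_le_two
  have hG' := h'.memLp_gradient.integrable one_le_two
  have hI : IntegrableOn (fun x => G x - G' x) Ω := hG.sub hG'
  have key := hΩ.ae_eq_zero_of_integral_contDiff_smul_eq_zero (μ := volume)
    hI.locallyIntegrableOn fun ψ hψ hψc hψΩ => by
      have ht : IsTestFunction Ω ψ := ⟨hψ, hψc, hψΩ⟩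
      obtain ⟨B, hB⟩ := ht.exists_bound
      have hint : ∀ {G : RSpace n → RSpace n}, Integrable G (volume.restrict Ω) →
          Integrable (fun x => ψ x • G x) (volume.restrict Ω) := fun hG =>
        hG.bdd_smul B hψ.continuous.aestronglyMeasurable
          (Eventually.of_forall hB)
      have e1 : ∫ x, ψ x • (G x - G' x) = ∫ x in Ω, ψ x • (G x - G' x) :=
        (setIntegral_eq_integral_of_forall_compl_eq_zero fun x hx => by
          rw [image_eq_zero_of_notMem_tsupport fun h => hx (hψΩ h), zero_smul]).symm
      rw [e1]
      refine ext_inner_right ℝ fun v => ?_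
      rw [inner_zero_left]
      simp only [smul_sub]
      rw [integral_sub (hint hG) (hint hG'), inner_sub_left]
      have e2 : ∀ {G : RSpace n → RSpace n}, HasH1Gradient Ω z G →
          Integrable G (volume.restrict Ω) →
          (inner ℝ (∫ x in Ω, ψ x • G x) v : ℝ) = -∫ x in Ω, z x * fderiv ℝ ψ x v := by
        intro G hG hGi
        rw [hG.integral_eq ψ ht v, neg_neg, real_inner_comm, ← integral_inner (hint hGi)]
        refine integral_congr_ae (Eventually.of_forall fun x => ?_)
        simp only [inner_smul_right]
        rw [real_inner_comm, mul_comm]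
      rw [e2 h hG, e2 h' hG', sub_self]
  rw [EventuallyEq, ae_restrict_iff' hΩ.measurableSet]
  filter_upwards [key] with x hx hxΩ
  exact sub_eq_zero.1 (hx hxΩ)

/-- A weak solution with its boundary values, approximated by smooth functions. -/
structure IsApproxSolution (Ω : Set (RSpace n)) (a z φ : RSpace n → ℝ) (G : RSpace n → RSpace n)
    (g : ℕ → RSpace n → ℝ) : Prop where
  approx : IsSmoothApprox Ω z G g
  memLp : MemLp z 2 (volume.restrict Ω)
  tendsto_boundary : ∀ᵐ y ∂(surfaceMeasure Ω), Tendsto (fun k => g k y) atTop (𝓝 (φ y))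
  equation : ∀ ψ, IsTestFunction Ω ψ →
    ∫ x in Ω, (inner ℝ (G x) (gradient ψ x) + a x * z x * ψ x) = 0

/-- The equation and the trace each supply a weak gradient; uniqueness identifies them. Two
successive extractions of subsequences give convergence almost everywhere in `Ω` and on the
frontier. -/
theorem IsWeakSolution.exists_approx {Ω : Set (RSpace n)} (hΩ : IsOpen Ω)
    (hb : Bornology.IsBounded Ω) {a z φ : RSpace n → ℝ} (hz : IsWeakSolution Ω a z)
    (hφ : HasTrace Ω z φ) : ∃ G g, IsApproxSolution Ω a z φ G g := by
  obtain ⟨G', hG', heq⟩ := hz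
  obtain ⟨hφ2, G, hG, g, hg, hl, hlg, hlb⟩ := hφ
  have hm1 := tendstoInMeasure_of_tendsto_eLpNorm (p := 2) (by norm_num)
    (fun k => (hg k).continuous.aestronglyMeasurable) hG.memLp.1 hl
  obtain ⟨ns, hns, hae⟩ := hm1.exists_seq_tendsto_ae
  have hm2 := tendstoInMeasure_of_tendsto_eLpNorm (p := 2) (by norm_num)
    (fun k => (hg (ns k)).continuous.aestronglyMeasurable) hφ2.1
    (hlb.comp hns.tendsto_atTop)
  obtain ⟨ms, hms, hae2⟩ := hm2.exists_seq_tendsto_ae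
  refine ⟨G, fun k => g (ns (ms k)), ⟨hG.memLp_gradient, fun k => hg _, ?_,
    hlg.comp (hns.tendsto_atTop.comp hms.tendsto_atTop)⟩, hG.memLp, hae2, fun ψ hψ => ?_⟩
  · filter_upwards [hae] with x hx using hx.comp hms.tendsto_atTop
  · rw [← heq ψ hψ]
    refine integral_congr_ae ?_
    filter_upwards [hG.ae_eq hΩ hb hG'] with x hx
    rw [hx]

theorem gradient_neg (f : RSpace n → ℝ) (x : RSpace n) :
    gradient (fun y => -f y) x = -gradient f x := by
  simp [gradient, fderiv_fun_neg]

theorem IsApproxSolution.neg {Ω : Set (RSpace n)} {a z φ : RSpace n → ℝ} {G : RSpace n → RSpace n}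
    {g : ℕ → RSpace n → ℝ} (S : IsApproxSolution Ω a z φ G g) :
    IsApproxSolution Ω a (fun x => -z x) (fun x => -φ x) (fun x => -G x) (fun k x => -g k x) where
  approx :=
    { memLp_gradient := S.approx.memLp_gradient.neg
      contDiff := fun k => (S.approx.contDiff k).neg
      tendsto_ae := S.approx.tendsto_ae.mono fun x hx => hx.neg
      tendsto_gradient := by
        refine S.approx.tendsto_gradient.congr fun k => ?_
        rw [← eLpNorm_neg]
        congr 1
        ext1 x
        simp only [Pi.neg_apply, gradient_neg]
        abel }
  memLp := S.memLp.neg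
  tendsto_boundary := S.tendsto_boundary.mono fun x hx => hx.neg
  equation := fun ψ hψ => by
    have := S.equation ψ hψ
    rw [← neg_eq_zero, ← integral_neg] at this
    rw [← this]
    refine integral_congr_ae (Eventually.of_forall fun x => ?_)
    simp only [inner_neg_left]
    ring

/-! ### Separable barriers and the equation for `z - W` -/

/-- Sums of functions of one variable. -/
def separable (ω : ℝ → ℝ) (b x : RSpace n) : ℝ := ∑ i, ω (x i - b i)

theorem contDiff_separable {ω : ℝ → ℝ} (hω : ContDiff ℝ (⊤ : ℕ∞) ω) (b : RSpace n) :
    ContDiff ℝ (⊤ : ℕ∞) (separable ω b) := by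
  unfold separable
  refine ContDiff.sum fun i _ => hω.comp ?_
  exact ((EuclideanSpace.proj i : RSpace n →L[ℝ] ℝ).contDiff).sub contDiff_const

theorem hasFDerivAt_coord_comp {ω ω' : ℝ → ℝ} (h : ∀ t, HasDerivAt ω (ω' t) t) (b : RSpace n)
    (i : Fin n) (x : RSpace n) :
    HasFDerivAt (fun x : RSpace n => ω (x i - b i))
      (ω' (x i - b i) • (EuclideanSpace.proj i : RSpace n →L[ℝ] ℝ)) x :=
  (h (x i - b i)).comp_hasFDerivAt x
    ((EuclideanSpace.proj i : RSpace n →L[ℝ] ℝ).hasFDerivAt.sub_const (b i))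

theorem integral_coord_mul_fderiv {ω₁ ω₂ : ℝ → ℝ}
    (h12 : ∀ t, HasDerivAt ω₁ (ω₂ t) t) (h2 : Continuous ω₂) (b : RSpace n) {ψ : RSpace n → ℝ}
    (hψ : ContDiff ℝ (⊤ : ℕ∞) ψ) (hψc : HasCompactSupport ψ) (i : Fin n) :
    Integrable (fun x : RSpace n => ω₁ (x i - b i) * fderiv ℝ ψ x (EuclideanSpace.single i 1)) ∧
    Integrable (fun x : RSpace n => ω₂ (x i - b i) * ψ x) ∧
    ∫ x : RSpace n, ω₁ (x i - b i) * fderiv ℝ ψ x (EuclideanSpace.single i 1) =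
      -∫ x : RSpace n, ω₂ (x i - b i) * ψ x := by
  have h1 : Continuous ω₁ := continuous_iff_continuousAt.2 fun t => (h12 t).continuousAt
  have hcoord : Continuous fun x : RSpace n => x i - b i := by fun_prop
  have hdψ : Continuous fun x => fderiv ℝ ψ x (EuclideanSpace.single i 1) :=
    (hψ.continuous_fderiv (by simp)).clm_apply continuous_const
  have hmul : ∀ {f g : RSpace n → ℝ}, Continuous f → Continuous g → HasCompactSupport g →
      Integrable fun x => f x * g x := fun hf hg hgc =>
    (hf.mul hg).integrable_of_hasCompactSupport hgc.mul_left
  have hc1 := hmul (h1.comp hcoord) hdψ (hψc.fderiv_apply ℝ _)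
  have hc2 := hmul (h2.comp hcoord) hψ.continuous hψc
  have hc3 := hmul (h1.comp hcoord) hψ.continuous hψc
  have hfd : ∀ x : RSpace n, fderiv ℝ (fun x : RSpace n => ω₁ (x i - b i)) x
      (EuclideanSpace.single i 1) = ω₂ (x i - b i) := fun x => by
    rw [(hasFDerivAt_coord_comp h12 b i x).fderiv]
    simp
  refine ⟨hc1, hc2, ?_⟩
  have := integral_mul_fderiv_eq_neg_fderiv_mul_of_integrable (μ := volume)
    (f := fun x : RSpace n => ω₁ (x i - b i)) (g := ψ) (v := EuclideanSpace.single i 1)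
    (by simp only [hfd]; exact hc2) hc1 hc3
    (fun x _ => (hasFDerivAt_coord_comp h12 b i x).differentiableAt)
    (fun x _ => hψ.differentiable (by simp) x)
  simpa only [hfd] using this

theorem inner_gradient_separable {ω ω₁ : ℝ → ℝ} (h01 : ∀ t, HasDerivAt ω (ω₁ t) t) (b : RSpace n)
    (ψ : RSpace n → ℝ) (x : RSpace n) :
    (inner ℝ (gradient (separable ω b) x) (gradient ψ x) : ℝ) =
      ∑ i, ω₁ (x i - b i) * fderiv ℝ ψ x (EuclideanSpace.single i 1) := by
  have hd : HasFDerivAt (separable ω b)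
      (∑ i, ω₁ (x i - b i) • (EuclideanSpace.proj i : RSpace n →L[ℝ] ℝ)) x :=
    HasFDerivAt.fun_sum fun i _ => hasFDerivAt_coord_comp h01 b i x
  have hc : ∀ i, (gradient ψ x) i = fderiv ℝ ψ x (EuclideanSpace.single i 1) := fun i => by
    rw [← inner_gradient_left, EuclideanSpace.inner_single_right]
    simp
  rw [inner_gradient_left, hd.fderiv]
  simp [hc]

/-- Integration by parts one coordinate at a time, with `ΔW = ∑ ω''(xᵢ - bᵢ)`. The compact support
of `ψ` in `Ω` allows passing to integrals over the whole space. -/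
theorem integral_gradient_separable {Ω : Set (RSpace n)} {ω ω₁ ω₂ : ℝ → ℝ}
    (h01 : ∀ t, HasDerivAt ω (ω₁ t) t)
    (h12 : ∀ t, HasDerivAt ω₁ (ω₂ t) t) (h2 : Continuous ω₂) (b : RSpace n) {ψ : RSpace n → ℝ}
    (hψ : IsTestFunction Ω ψ) :
    ∫ x in Ω, inner ℝ (gradient (separable ω b) x) (gradient ψ x) =
      -∫ x in Ω, separable ω₂ b x * ψ x := by
  have hψ0 : ∀ x ∉ Ω, ψ x = 0 := fun x hx =>
    image_eq_zero_of_notMem_tsupport fun h => hx (hψ.tsupport_subset h)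
  have hgψ0 : ∀ x ∉ Ω, gradient ψ x = 0 := fun x hx => by
    have : fderiv ℝ ψ x = 0 := by
      by_contra h
      exact hx (hψ.tsupport_subset (support_fderiv_subset ℝ h))
    simp [gradient, this]
  have key := integral_coord_mul_fderiv h12 h2 b hψ.smooth hψ.hasCompactSupport
  rw [setIntegral_eq_integral_of_forall_compl_eq_zero fun x hx => by rw [hgψ0 x hx, inner_zero_right],
    setIntegral_eq_integral_of_forall_compl_eq_zero fun x hx => by rw [hψ0 x hx, mul_zero]]
  simp only [inner_gradient_separable h01, separable, Finset.sum_mul]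
  rw [integral_finsetSum _ fun i _ => (key i).1, integral_finsetSum _ fun i _ => (key i).2.1,
    ← Finset.sum_neg_distrib]
  exact Finset.sum_congr rfl fun i _ => (key i).2.2

theorem IsSmoothApprox.sub {Ω : Set (RSpace n)} (hΩ : IsOpen Ω) (hb : Bornology.IsBounded Ω)
    {z W : RSpace n → ℝ} {G : RSpace n → RSpace n} {g : ℕ → RSpace n → ℝ}
    (A : IsSmoothApprox Ω z G g) (hW : ContDiff ℝ (⊤ : ℕ∞) W) :
    IsSmoothApprox Ω (fun x => z x - W x) (fun x => G x - gradient W x)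
      (fun k x => g k x - W x) where
  memLp_gradient := A.memLp_gradient.sub (MemLp.of_continuous_of_isBounded hΩ hb
    hW.continuous_gradient)
  contDiff := fun k => (A.contDiff k).sub hW
  tendsto_ae := A.tendsto_ae.mono fun x hx => hx.sub_const _
  tendsto_gradient := by
    refine A.tendsto_gradient.congr fun k => ?_
    congr 1
    ext1 x
    have : gradient (fun y => g k y - W y) x = gradient (g k) x - gradient W x := by
      unfold gradient
      rw [fderiv_fun_sub ((A.contDiff k).differentiable (by simp) x)
        (hW.differentiable (by simp) x), map_sub]
    rw [this]
    abel

theorem IsApproxSolution.equation_sub {Ω : Set (RSpace n)} (hΩ : IsOpen Ω)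
    (hb : Bornology.IsBounded Ω) {a z φ : RSpace n → ℝ} {G : RSpace n → RSpace n}
    {g : ℕ → RSpace n → ℝ} (S : IsApproxSolution Ω a z φ G g) (ha : MemLp a ⊤ (volume.restrict Ω))
    {ω ω₁ ω₂ : ℝ → ℝ}
    (h0 : ContDiff ℝ (⊤ : ℕ∞) ω) (h01 : ∀ t, HasDerivAt ω (ω₁ t) t)
    (h12 : ∀ t, HasDerivAt ω₁ (ω₂ t) t) (h2 : Continuous ω₂) (b : RSpace n) :
    MemLp (fun x => a x * z x - separable ω₂ b x) 2 (volume.restrict Ω) ∧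
    ∀ ψ, IsTestFunction Ω ψ → ∫ x in Ω, (inner ℝ (G x - gradient (separable ω b) x) (gradient ψ x) +
      (a x * z x - separable ω₂ b x) * ψ x) = 0 := by
  have hsep : Continuous (separable ω₂ b) := by unfold separable; fun_prop
  have haz : MemLp (fun x => a x * z x) 2 (volume.restrict Ω) := S.memLp.mul ha
  have hs2 : MemLp (separable ω₂ b) 2 (volume.restrict Ω) :=
    MemLp.of_continuous_of_isBounded hΩ hb hsep
  refine ⟨haz.sub hs2, fun ψ hψ => ?_⟩
  have hgψ : MemLp (gradient ψ) 2 (volume.restrict Ω) :=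
    MemLp.of_continuous_of_isBounded hΩ hb hψ.smooth.continuous_gradient
  have hψ2 : MemLp ψ 2 (volume.restrict Ω) :=
    MemLp.of_continuous_of_isBounded hΩ hb hψ.smooth.continuous
  have hW := (contDiff_separable h0 b).continuous_gradient
  have i1 := S.approx.memLp_gradient.integrable_inner hgψ
  have i2 : Integrable (fun x => a x * z x * ψ x) (volume.restrict Ω) := haz.integrable_mul hψ2
  have i3 := (MemLp.of_continuous_of_isBounded hΩ hb hW).integrable_inner hgψ
  have i4 : Integrable (fun x => separable ω₂ b x * ψ x) (volume.restrict Ω) :=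
    hs2.integrable_mul hψ2
  have e1 := S.equation ψ hψ
  have e2 := integral_gradient_separable h01 h12 h2 b hψ
  have i12 := i1.add i2
  have i34 := i3.add i4
  simp only [Pi.add_def] at i12 i34
  have e3 : ∫ x in Ω, (inner ℝ (G x - gradient (separable ω b) x) (gradient ψ x) +
      (a x * z x - separable ω₂ b x) * ψ x) =
      ∫ x in Ω, ((inner ℝ (G x) (gradient ψ x) + a x * z x * ψ x) -
        (inner ℝ (gradient (separable ω b) x) (gradient ψ x) + separable ω₂ b x * ψ x)) := by
    refine integral_congr_ae (Eventually.of_forall fun x => ?_)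
    simp only [inner_sub_left]
    ring
  rw [e3, integral_sub i12 i34, e1, integral_add i3 i4, e2]
  ring

/-! ### Global bound and interior decay -/

/-- The weak maximum principle: a solution is bounded above by its boundary values. -/
theorem IsApproxSolution.le_of_boundary_le {Ω : Set (RSpace n)} (hn : 1 ≤ n)
    (hΩ : IsBoundedLipschitzDomain Ω) {a z φ : RSpace n → ℝ} {G : RSpace n → RSpace n}
    {g : ℕ → RSpace n → ℝ} (S : IsApproxSolution Ω a z φ G g)
    (ha : MemLp a ⊤ (volume.restrict Ω)) (ha0 : ∀ᵐ x ∂(volume.restrict Ω), 0 ≤ a x)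
    {M : ℝ} (hM : 0 ≤ M) (hφ : ∀ᵐ y ∂(surfaceMeasure Ω), φ y ≤ M) :
    ∀ᵐ x ∂(volume.restrict Ω), z x ≤ M := by
  have hn0 : (0 : ℝ) < n := by exact_mod_cast hn
  obtain ⟨R, hR⟩ := hΩ.isBounded.closure.subset_closedBall (0 : RSpace n)
  have key : ∀ η : ℝ, 0 < η → ∀ᵐ x ∂(volume.restrict Ω), z x ≤ M + η * R ^ 2 := by
    intro η hη
    -- The sum over the coordinates is `M + η (R² - |x|²)`, at least `M` on the closure of `Ω`. Its
    -- Laplacian `-2 n η` is negative, which supplies the strict sign even where `a = 0`.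
    set ω : ℝ → ℝ := fun t => (M + η * R ^ 2) / n - η * t ^ 2 with hω
    have h0 : ContDiff ℝ (⊤ : ℕ∞) ω := by fun_prop
    have h01 : ∀ t, HasDerivAt ω (-2 * η * t) t := fun t => by
      have := ((hasDerivAt_pow 2 t).const_mul η).const_sub ((M + η * R ^ 2) / n)
      convert! this using 1
      simp; ring
    have h12 : ∀ t : ℝ, HasDerivAt (fun t => -2 * η * t) (-2 * η) t := fun t => by
      simpa using (hasDerivAt_id t).const_mul (-2 * η)
    have hW : ∀ x : RSpace n, separable ω 0 x = M + η * R ^ 2 - η * ‖x‖ ^ 2 := fun x => by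
      simp only [separable, hω, Finset.sum_sub_distrib, ← Finset.mul_sum, EuclideanSpace.norm_sq_eq]
      simp
      field_simp
    have hWM : ∀ x ∈ closure Ω, M ≤ separable ω 0 x := fun x hx => by
      have h1 : ‖x‖ ≤ R := by simpa using hR hx
      have h2 : ‖x‖ ^ 2 ≤ R ^ 2 := by gcongr
      rw [hW]
      nlinarith
    have A := S.approx.sub hΩ.isOpen hΩ.isBounded (contDiff_separable h0 0)
    obtain ⟨hf, heq⟩ := S.equation_sub hΩ.isOpen hΩ.isBounded ha h0 h01 h12 continuous_const 0
    have hbd : ∀ᵐ y ∂(surfaceMeasure Ω),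
        Tendsto (fun k => expNegInvGlue (g k y - separable ω 0 y)) atTop (𝓝 0) := by
      have hfr : ∀ᵐ y ∂(surfaceMeasure Ω), y ∈ frontier Ω :=
        ae_restrict_mem isClosed_frontier.measurableSet
      filter_upwards [S.tendsto_boundary, hφ, hfr] with y hy hφy hyf
      have h1 : φ y - separable ω 0 y ≤ 0 := by
        linarith [hWM y (frontier_subset_closure hyf)]
      have := (expNegInvGlue.continuous.tendsto _).comp (hy.sub_const (separable ω 0 y))
      rwa [expNegInvGlue.zero_of_nonpos h1] at this
    have hpos : ∀ᵐ x ∂(volume.restrict Ω), 0 < z x - separable ω 0 x →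
        0 < a x * z x - separable (fun _ => -2 * η) 0 x := by
      filter_upwards [ha0, ae_restrict_mem hΩ.isOpen.measurableSet] with x hax hxΩ hx
      have h1 := hWM x (subset_closure hxΩ)
      have h2 : separable (fun _ => -2 * η) 0 x = n * (-2 * η) := by simp [separable]
      have h3 : 0 ≤ a x * z x := mul_nonneg hax (by linarith)
      rw [h2]
      nlinarith [mul_pos hn0 hη]
    filter_upwards [A.nonpos_of_boundary hn hΩ hbd hf heq hpos] with x hx
    rw [hW] at hx
    nlinarith [mul_nonneg hη.le (sq_nonneg ‖x‖)]
  have hall := ae_all_iff.2 fun m : ℕ => key (1 / ((m : ℝ) + 1)) (by positivity)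
  filter_upwards [hall] with x hx
  have hlim := (tendsto_one_div_add_atTop_nhds_zero_nat (𝕜 := ℝ)).mul_const (R ^ 2)
  have := hlim.const_add M
  rw [zero_mul, add_zero] at this
  exact ge_of_tendsto' this hx

/-- Exponential smallness in the interior of a ball on which the potential is at least `lam ^ 2`. -/
theorem IsApproxSolution.le_exp {Ω : Set (RSpace n)} (hn : 1 ≤ n) (hΩ : IsOpen Ω)
    (hb : Bornology.IsBounded Ω) {a z φ : RSpace n → ℝ} {G : RSpace n → RSpace n}
    {g : ℕ → RSpace n → ℝ} (S : IsApproxSolution Ω a z φ G g)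
    (ha : MemLp a ⊤ (volume.restrict Ω)) {M lam ρ : ℝ} (hM : 0 ≤ M)
    (hz : ∀ᵐ x ∂(volume.restrict Ω), z x ≤ M) (hlam : 0 < lam) (hρ : 0 < ρ) {b : RSpace n}
    (hball : Metric.closedBall b (2 * ρ) ⊆ Ω)
    (hal : ∀ᵐ x ∂(volume.restrict (Metric.ball b (2 * ρ))), lam ^ 2 ≤ a x) :
    ∀ᵐ x ∂(volume.restrict (Metric.ball b (ρ / (2 * √n)))),
      z x ≤ 2 * n * M * Real.exp (-(ρ / (2 * √n)) * lam) := by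
  have hn0 : (1 : ℝ) ≤ n := by exact_mod_cast hn
  have hsn : 1 ≤ √(n : ℝ) := Real.one_le_sqrt.2 hn0
  -- A point at distance at least `ρ` from `b` has some coordinate with `|xᵢ - bᵢ| ≥ s`. The
  -- normalization of `κ` makes that single summand at least `M`.
  set s := ρ / √n with hs
  have hs0 : 0 < s := by positivity
  set κ := M / Real.cosh (lam * s) with hκ
  have hκ0 : 0 ≤ κ := div_nonneg hM (Real.cosh_pos _).le
  set ω : ℝ → ℝ := fun t => κ * Real.cosh (lam * t) with hω
  have h0 : ContDiff ℝ (⊤ : ℕ∞) ω :=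
    contDiff_const.mul (Real.contDiff_cosh.comp (contDiff_const.mul contDiff_id))
  have hl : ∀ t, HasDerivAt (fun t => lam * t) lam t := fun t => by
    simpa using (hasDerivAt_id t).const_mul lam
  have h01 : ∀ t, HasDerivAt ω (κ * (Real.sinh (lam * t) * lam)) t := fun t =>
    (((Real.hasDerivAt_cosh (lam * t)).comp t (hl t)).const_mul κ)
  have h12 : ∀ t, HasDerivAt (fun t => κ * (Real.sinh (lam * t) * lam))
      (lam ^ 2 * ω t) t := fun t => by
    have := ((((Real.hasDerivAt_sinh (lam * t)).comp t (hl t)).mul_const lam).const_mul κ)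
    convert! this using 1
    simp only [hω]; ring
  have h2 : Continuous fun t => lam ^ 2 * ω t := continuous_const.mul h0.continuous
  have hω0 : ∀ t, 0 ≤ ω t := fun t => mul_nonneg hκ0 (Real.cosh_pos _).le
  have hW0 : ∀ x, 0 ≤ separable ω b x := fun x => Finset.sum_nonneg fun i _ => hω0 _
  have hWM : ∀ x ∉ Metric.ball b ρ, M ≤ separable ω b x := by
    intro x hx
    have h1 : ρ ≤ ‖x - b‖ := by simpa [dist_eq_norm] using hx
    have h3 : ∃ i, s ≤ |x i - b i| := by
      by_contra! hlt
      have h4 : ‖x - b‖ ^ 2 < n * s ^ 2 := by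
        rw [EuclideanSpace.norm_sq_eq]
        calc ∑ i, ‖(x - b) i‖ ^ 2 < ∑ _i : Fin n, s ^ 2 := by
              refine Finset.sum_lt_sum_of_nonempty ⟨⟨0, hn⟩, Finset.mem_univ _⟩ fun i _ => ?_
              have := hlt i
              simp only [PiLp.sub_apply, Real.norm_eq_abs]
              gcongr
          _ = n * s ^ 2 := by simp
      have h5 : (n : ℝ) * s ^ 2 = ρ ^ 2 := by
        rw [hs, div_pow, Real.sq_sqrt (by linarith)]
        field_simp
      rw [h5] at h4
      exact absurd (lt_of_pow_lt_pow_left₀ 2 hρ.le h4) (not_lt.2 h1)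
    obtain ⟨i, hi⟩ := h3
    calc M = κ * Real.cosh (lam * s) := (div_mul_cancel₀ _ (Real.cosh_pos _).ne').symm
      _ ≤ ω (x i - b i) := by
        refine mul_le_mul_of_nonneg_left (Real.cosh_le_cosh.2 ?_) hκ0
        rw [abs_mul, abs_mul, abs_of_pos hs0]
        gcongr
      _ ≤ separable ω b x := Finset.single_le_sum (f := fun i => ω (x i - b i))
        (fun i _ => hω0 _) (Finset.mem_univ i)
  have hWle : ∀ x ∈ Metric.ball b (ρ / (2 * √n)),
      separable ω b x ≤ 2 * n * M * Real.exp (-(ρ / (2 * √n)) * lam) := by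
    intro x hx
    have hs2 : ρ / (2 * √n) = s / 2 := by rw [hs]; field_simp
    rw [hs2] at hx ⊢
    have h1 : ‖x - b‖ < s / 2 := by simpa [dist_eq_norm] using hx
    -- On the ball of radius `s / 2`, `cosh (λ s / 2) / cosh (λ s) ≤ 2 exp (-λ s / 2)`.
    have hterm : ∀ i, ω (x i - b i) ≤ 2 * M * Real.exp (-(s / 2) * lam) := fun i => by
      have h3 : |x i - b i| ≤ s / 2 := by
        have := PiLp.norm_apply_le (x - b) i
        simp only [PiLp.sub_apply, Real.norm_eq_abs] at this
        linarith
      have h4 : Real.cosh (lam * (x i - b i)) ≤ Real.exp (lam * (s / 2)) := by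
        calc Real.cosh (lam * (x i - b i)) ≤ Real.cosh (lam * (s / 2)) := by
              refine Real.cosh_le_cosh.2 ?_
              rw [abs_mul, abs_mul, abs_of_pos (half_pos hs0)]
              gcongr
          _ ≤ Real.exp (lam * (s / 2)) := by
              rw [Real.cosh_eq]
              have : Real.exp (-(lam * (s / 2))) ≤ Real.exp (lam * (s / 2)) :=
                Real.exp_le_exp.2 (by have := mul_pos hlam hs0; linarith)
              linarith
      have h5 : Real.exp (lam * s) / 2 ≤ Real.cosh (lam * s) := by
        rw [Real.cosh_eq]
        have := Real.exp_pos (-(lam * s))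
        linarith
      have h6 : Real.exp (lam * (s / 2)) = Real.exp (-(s / 2) * lam) * Real.exp (lam * s) := by
        rw [← Real.exp_add]; congr 1; ring
      calc ω (x i - b i) ≤ κ * Real.exp (lam * (s / 2)) := mul_le_mul_of_nonneg_left h4 hκ0
        _ ≤ 2 * M * Real.exp (-(s / 2) * lam) := by
          rw [hκ, div_mul_eq_mul_div, div_le_iff₀ (Real.cosh_pos _), h6]
          have := mul_le_mul_of_nonneg_left h5
            (mul_nonneg hM (Real.exp_pos (-(s / 2) * lam)).le)
          linarith
    calc separable ω b x ≤ ∑ _i : Fin n, 2 * M * Real.exp (-(s / 2) * lam) :=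
          Finset.sum_le_sum fun i _ => hterm i
      _ = _ := by simp; ring
  -- The bump is `1` on the ball of radius `ρ`, so its gradient can be nonzero only where `z ≤ M ≤
  -- W`, and the error term vanishes. Its support lies where `a ≥ λ²`, so `f ≥ λ² (z - W)` there
  -- when `z > W`.
  let χ : ContDiffBump b := ⟨ρ, 2 * ρ, hρ, by linarith⟩
  have hχ : IsTestFunction Ω χ :=
    ⟨χ.contDiff, χ.hasCompactSupport, by rw [χ.tsupport_eq]; exact hball⟩
  have A := S.approx.sub hΩ hb (contDiff_separable h0 b)
  obtain ⟨hf, heq⟩ := S.equation_sub hΩ hb ha h0 h01 h12 h2 b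
  have hgrad : ∀ᵐ x ∂(volume.restrict Ω), z x - separable ω b x ≤ 0 ∨ gradient χ x = 0 := by
    filter_upwards [hz] with x hx
    by_cases hxb : x ∈ Metric.ball b ρ
    · right
      have : χ =ᶠ[𝓝 x] fun _ => 1 := by
        filter_upwards [Metric.isOpen_ball.mem_nhds hxb] with y hy
        exact χ.one_of_mem_closedBall (Metric.ball_subset_closedBall hy)
      rw [this.gradient_eq, gradient_fun_const]
    · left
      linarith [hWM x hxb]
  have hbΩ : Metric.ball b (2 * ρ) ⊆ Ω := Metric.ball_subset_closedBall.trans hball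
  have hpos : ∀ᵐ x ∂(volume.restrict Ω), 0 < χ x → 0 < z x - separable ω b x →
      0 < a x * z x - separable (fun t => lam ^ 2 * ω t) b x := by
    rw [ae_restrict_iff' Metric.isOpen_ball.measurableSet] at hal
    filter_upwards [ae_restrict_of_ae hal] with x hax hχx hx
    have h1 : x ∈ Metric.ball b (2 * ρ) := by
      have : x ∈ Function.support χ := hχx.ne'
      rwa [χ.support_eq] at this
    have h3 : separable (fun t => lam ^ 2 * ω t) b x = lam ^ 2 * separable ω b x := by
      simp [separable, Finset.mul_sum]
    rw [h3]
    have h4 := hW0 x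
    have h5 := mul_le_mul_of_nonneg_right (hax h1) (show 0 ≤ z x by linarith)
    have h6 := mul_pos (pow_pos hlam 2) hx
    linarith
  have hsmall : Metric.ball b (ρ / (2 * √n)) ⊆ Metric.ball b (2 * ρ) := by
    refine Metric.ball_subset_ball ?_
    rw [div_le_iff₀ (by positivity)]
    nlinarith
  filter_upwards [ae_restrict_of_ae_restrict_of_subset (hsmall.trans hbΩ)
    (A.nonpos_of_cutoff hb hf heq hχ (fun _ => χ.nonneg) hgrad hpos),
    ae_restrict_mem Metric.isOpen_ball.measurableSet] with x hx hxb
  have := hx (χ.pos_of_mem_ball (hsmall hxb))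
  linarith [hWle x hxb]

theorem IsApproxSolution.abs_le_exp {Ω : Set (RSpace n)} (hn : 1 ≤ n)
    (hΩ : IsBoundedLipschitzDomain Ω) {a z φ : RSpace n → ℝ} {G : RSpace n → RSpace n}
    {g : ℕ → RSpace n → ℝ} (S : IsApproxSolution Ω a z φ G g)
    (ha : MemLp a ⊤ (volume.restrict Ω)) (ha0 : ∀ᵐ x ∂(volume.restrict Ω), 0 ≤ a x)
    {M lam ρ : ℝ} (hM : 0 ≤ M) (hφ : ∀ᵐ y ∂(surfaceMeasure Ω), |φ y| ≤ M)
    (hlam : 0 < lam) (hρ : 0 < ρ) {b : RSpace n}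
    (hball : Metric.closedBall b (2 * ρ) ⊆ Ω)
    (hal : ∀ᵐ x ∂(volume.restrict (Metric.ball b (2 * ρ))), lam ^ 2 ≤ a x) :
    ∀ᵐ x ∂(volume.restrict (Metric.ball b (ρ / (2 * √n)))),
      |z x| ≤ 2 * n * M * Real.exp (-(ρ / (2 * √n)) * lam) := by
  have h1 := S.le_of_boundary_le hn hΩ ha ha0 hM (hφ.mono fun y hy => (abs_le.1 hy).2)
  have h2 := S.neg.le_of_boundary_le hn hΩ ha ha0 hM
    (hφ.mono fun y hy => neg_le.1 (abs_le.1 hy).1)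
  filter_upwards [S.le_exp hn hΩ.isOpen hΩ.isBounded ha hM h1 hlam hρ hball hal,
    S.neg.le_exp hn hΩ.isOpen hΩ.isBounded ha hM h2 hlam hρ hball hal] with x hx hx'
  exact abs_le.2 ⟨neg_le.1 hx', hx⟩

end

/-! ### The estimate on `K₀` -/

theorem lemmaA {n : ℕ} (hn : 1 ≤ n) (Ω U K₀ : Set (RSpace n))
    (hΩ : IsBoundedLipschitzDomain Ω) (hU : IsOpen U) (hK₀ : IsOpen K₀)
    (hK₀U : CompactlyContained K₀ U) (hUΩ : CompactlyContained U Ω) :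
    ∃ C c : ℝ, 0 < C ∧ 0 < c ∧
      ∀ (ε q₀ : ℝ) (q z φ : RSpace n → ℝ), 0 < ε → 0 < q₀ →
        MemLp q ⊤ (volume.restrict Ω) →
        (∀ᵐ x ∂(volume.restrict Ω), 0 ≤ q x) →
        (∀ᵐ x ∂(volume.restrict U), q₀ ≤ q x) →
        IsWeakSolution Ω (fun x => q x / ε) z →
        HasTrace Ω z φ →
        MemLp φ ⊤ (surfaceMeasure Ω) →
        eLpNorm z ⊤ (volume.restrict K₀) ≤
          ENNReal.ofReal C * eLpNorm φ ⊤ (surfaceMeasure Ω) *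
            ENNReal.ofReal (Real.exp (-c * Real.sqrt (q₀ / ε))) := by
  obtain ⟨δ, hδ, hδU⟩ := hK₀U.1.exists_cthickening_subset_open hU hK₀U.2
  have hn0 : (1 : ℝ) ≤ n := by exact_mod_cast hn
  have hsn : 0 < √(n : ℝ) := Real.sqrt_pos.2 (by linarith)
  -- Take `ρ = δ / 2`, so that the balls of radius `2 ρ = δ` centred in `K₀` lie in `U`. Both
  -- constants depend only on `n` and `δ`: the maximum principle up to the boundary costs no
  -- constant.
  refine ⟨2 * n, δ / 2 / (2 * √n), by positivity, by positivity, ?_⟩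
  intro ε q₀ q z φ hε hq₀ hq hq0 hqU hz hφ hφi
  obtain ⟨G, g, S⟩ := hz.exists_approx hΩ.isOpen hΩ.isBounded hφ
  set M := (eLpNorm φ ⊤ (surfaceMeasure Ω)).toReal with hM
  have hφM : ∀ᵐ y ∂(surfaceMeasure Ω), |φ y| ≤ M := by
    filter_upwards [ae_le_eLpNormEssSup (f := φ) (μ := surfaceMeasure Ω)] with y hy
    rw [hM, eLpNorm_exponent_top, ← Real.norm_eq_abs, ← toReal_enorm]
    exact ENNReal.toReal_mono (by simpa using hφi.2.ne) hy
  have ha : MemLp (fun x => q x / ε) ⊤ (volume.restrict Ω) := by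
    simpa only [div_eq_mul_inv] using hq.mul_const ε⁻¹
  have ha0 : ∀ᵐ x ∂(volume.restrict Ω), 0 ≤ q x / ε := hq0.mono fun x hx => div_nonneg hx hε.le
  set B := 2 * n * M * Real.exp (-(δ / 2 / (2 * √n)) * √(q₀ / ε)) with hB
  have hloc : ∀ b ∈ K₀, ∀ᵐ x ∂(volume.restrict (Metric.ball b (δ / 2 / (2 * √n)))), |z x| ≤ B := by
    intro b hb
    have h2 : 2 * (δ / 2) = δ := by ring
    have hsub : Metric.closedBall b (2 * (δ / 2)) ⊆ U := by
      rw [h2]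
      exact (Metric.closedBall_subset_cthickening (subset_closure hb) δ).trans hδU
    refine S.abs_le_exp hn hΩ ha ha0 ENNReal.toReal_nonneg hφM (Real.sqrt_pos.2 (by positivity))
      (half_pos hδ) (hsub.trans (subset_closure.trans hUΩ.2)) ?_
    rw [Real.sq_sqrt (by positivity)]
    filter_upwards [ae_restrict_of_ae_restrict_of_subset
      (Metric.ball_subset_closedBall.trans hsub) hqU] with x hx
    gcongr
  have hae : ∀ᵐ x ∂(volume.restrict K₀), ‖z x‖ ≤ B := by
    rw [ae_restrict_iff' hK₀.measurableSet, ae_iff]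
    -- The bound `B` and the radius do not depend on `b`, so the local bounds patch to a bound
    -- almost everywhere on `K₀`.
    refine measure_null_of_locally_null _ fun b hb => ?_
    simp only [Set.mem_ofPred_eq, Classical.not_imp] at hb
    have h1 := hloc b hb.1
    rw [ae_restrict_iff' Metric.isOpen_ball.measurableSet, ae_iff] at h1
    refine ⟨_, inter_mem_nhdsWithin _ (Metric.ball_mem_nhds b
      (show 0 < δ / 2 / (2 * √n) by positivity)), measure_mono_null (fun x hx => ?_) h1⟩
    exact fun h => hx.1 fun _ => h hx.2
  calc eLpNorm z ⊤ (volume.restrict K₀) ≤ ENNReal.ofReal B := by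
        rw [eLpNorm_exponent_top]
        exact eLpNormEssSup_le_of_ae_bound hae
    _ = _ := by
        rw [hB, ENNReal.ofReal_mul (by positivity), ENNReal.ofReal_mul (by positivity), hM,
          ENNReal.ofReal_toReal hφi.2.ne]
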